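/- Let $p$ be an odd prime, $q$ a power of $p$, $k=\mathbb F_q$, let $1\le n\le p-1$, and let $r$ be a divisor of $\gcd(n+2,q-1)$. Let $A=A(n,k)$ be the space of homogeneous polynomials of degree $n$ in two variables over $k$, on which $D=k^\times\times GL_2(k)$ acts, $GL_2(k)$ by linear substitutions and $k^\times$ by scalars. Let $G=DA$ be the semidirect product, $U$ the Sylow $p$-subgroup of $D$ consisting of the pairs $(1,M)$ with $M$ upper unitriangular, $S=UA$, $Z=Z(S)$ and $R=ZU$. Let $H_R\le GL_3(k)$ be the stabilizer of the line spanned by the first standard basis vector, and let $B\le H_R$ be the Borel subgroup of upper triangular matrices. Let $\varphi\colon N_G(R)\to B$ be any isomorphism that maps $R$ onto the unipotent radical of $H_R$ (such isomorphisms exist), and form the free amalgamated product $F(1,n,k,R)=G*_{N_G(R)}H_R$ along the inclusion $N_G(R)\le G$ and $\varphi$. Let $F(r,n,k,R)$ be any subgroup of index $r$ of $F(1,n,k,R)$ that contains $O^{p'}(G)$ and $O^{p'}(H_R)$, and let $\mathcal F(r,n,k,R)=\mathcal F_S(F(r,n,k,R))$ be the fusion system over $S$ whose morphisms are the maps between subgroups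 of $S$ induced by conjugation by elements of $F(r,n,k,R)$. Then the Clelland–Parker fusion system $\mathcal F=\mathcal F(r,n,k,R)$ is of characteristic $p$-type. That is, $\mathcal F$ is saturated and, for every nontrivial fully $\mathcal F$-normalized subgroup $Q$ of $S$, the normalizer fusion system $N_{\mathcal F}(Q)$ over $N_S(Q)$ is constrained, which means that it is saturated and has a normal subgroup $N$ that is centric (every conjugate of $N$ in $N_{\mathcal F}(Q)$ contains its own centralizer in $N_S(Q)$). -/

import Mathlib

universe u

/-! ### Fusion systems -/

/-- A fusion system over a group `S` (in the application a finite `p`-group): a category whose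
objects are the subgroups of `S`, whose morphisms are injective group homomorphisms, which contains
all maps induced by conjugation in `S`, and in which every morphism is an isomorphism of the
category followed by an inclusion. -/
structure FusionSystem (S : Type u) [Group S] where
  /-- the set of morphisms from `P` to `Q` -/
  hom : ∀ P Q : Subgroup S, Set (P →* Q)
  injective_of_mem : ∀ {P Q : Subgroup S} {f : P →* Q}, f ∈ hom P Q → Function.Injective f
  conj_mem : ∀ {P Q : Subgroup S} (f : P →* Q) (s : S),
    (∀ x : P, (f x : S) = s * x * s⁻¹) → f ∈ hom P Q
  comp_mem : ∀ {P Q R : Subgroup S} {f : P →* Q} {g : Q →* R},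
    f ∈ hom P Q → g ∈ hom Q R → g.comp f ∈ hom P R
  /-- if `e` is the corestriction to its image `R` of a morphism `f`, then `e` and `e⁻¹` are
  morphisms -/
  iso_mem : ∀ {P Q R : Subgroup S} {f : P →* Q} (e : P ≃* R),
    f ∈ hom P Q → (∀ x : P, (e x : S) = f x) →
      e.toMonoidHom ∈ hom P R ∧ e.symm.toMonoidHom ∈ hom R P

/-- The fusion system `F_S(G)` of a (possibly infinite) group `G` over a subgroup `S`: the morphisms
are the maps between subgroups of `S` which are induced by conjugation by elements of `G`. -/
def groupFusionSystem {G : Type u} [Group G] (S : Subgroup G) : FusionSystem S where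
  hom P Q := {f | ∃ g : G, ∀ x : P, ((f x : S) : G) = g * ((x : S) : G) * g⁻¹}
  injective_of_mem := by
    rintro P Q f ⟨g, hg⟩ x y hxy
    have h : g * ((x : S) : G) * g⁻¹ = g * ((y : S) : G) * g⁻¹ := by rw [← hg, ← hg, hxy]
    exact Subtype.ext (Subtype.ext (mul_left_cancel (mul_right_cancel h)))
  conj_mem := by
    intro P Q f s h
    exact ⟨s, fun x => by rw [h x]; rfl⟩
  comp_mem := by
    rintro P Q R f f' ⟨g, hg⟩ ⟨g', hg'⟩
    refine ⟨g' * g, fun x => ?_⟩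
    rw [MonoidHom.comp_apply, hg', hg]
    group
  iso_mem := by
    rintro P Q R f e ⟨g, hg⟩ h
    refine ⟨⟨g, fun x => ?_⟩, ⟨g⁻¹, fun y => ?_⟩⟩
    · rw [← hg x, ← h x]; rfl
    · obtain ⟨x, rfl⟩ := e.surjective y
      have h1 := hg x
      rw [← h x] at h1
      rw [h1, MulEquiv.toMonoidHom_eq_coe, MonoidHom.coe_coe, MulEquiv.symm_apply_apply]
      group

namespace FusionSystem

variable {S : Type u} [Group S]

/-- `P` and `Q` are conjugate (isomorphic) in the fusion system. -/
def IsConj (F : FusionSystem S) (P Q : Subgroup S) : Prop :=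
  ∃ e : P ≃* Q, e.toMonoidHom ∈ F.hom P Q

/-- The automorphism group `Aut_F(P)`. -/
def aut (F : FusionSystem S) (P : Subgroup S) : Subgroup (MulAut P) where
  carrier := {e | e.toMonoidHom ∈ F.hom P P}
  one_mem' := F.conj_mem _ 1 (fun x => by simp)
  mul_mem' := fun {a b} ha hb => F.comp_mem hb ha
  inv_mem' := fun {a} ha => (F.iso_mem a ha (fun _ => rfl)).2

/-- The group `Aut_S(P)` of automorphisms of `P` induced by conjugation by elements of `N_S(P)`. -/
def autBy (P : Subgroup S) : Subgroup (MulAut P) := P.normalizerMonoidHom.range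

/-- `P` is fully normalized: `|N_S(P)| ≥ |N_S(Q)|` for every conjugate `Q` of `P`. -/
def IsFullyNormalized (F : FusionSystem S) (P : Subgroup S) : Prop :=
  ∀ Q : Subgroup S, F.IsConj P Q →
    Nat.card (Subgroup.normalizer (Q : Set S)) ≤ Nat.card (Subgroup.normalizer (P : Set S))

/-- `P` is fully automized: `Aut_S(P)` is a Sylow `p`-subgroup of `Aut_F(P)`. -/
def IsFullyAutomized (F : FusionSystem S) (p : ℕ) (P : Subgroup S) : Prop :=
  ∃ T : Sylow p (F.aut P), (T : Subgroup (F.aut P)) = (autBy P).subgroupOf (F.aut P)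

/-- For an isomorphism `e : Q ≃* P`, the subgroup
`N_e = {g ∈ N_S(Q) : e ∘ c_g ∘ e⁻¹ ∈ Aut_S(P)}` of `S`. -/
def extensionDomain {Q P : Subgroup S} (e : Q ≃* P) : Subgroup S :=
  ((autBy P).comap ((MulAut.congr e).toMonoidHom.comp Q.normalizerMonoidHom)).map
    (Subgroup.normalizer (Q : Set S)).subtype

/-- `P` is receptive: each isomorphism `e : Q ≃* P` in the fusion system extends to a morphism
defined on `N_e`. -/
def IsReceptive (F : FusionSystem S) (P : Subgroup S) : Prop :=
  ∀ (Q : Subgroup S) (e : Q ≃* P), e.toMonoidHom ∈ F.hom Q P →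
    ∃ f ∈ F.hom (extensionDomain e) ⊤,
      ∀ (x : Q) (y : extensionDomain e), (y : S) = x → (f y : S) = e x

/-- Saturation (for `S` a finite `p`-group): every subgroup is conjugate to one which is fully
automized and receptive. -/
def IsSaturated (F : FusionSystem S) (p : ℕ) : Prop :=
  ∀ P : Subgroup S, ∃ Q : Subgroup S, F.IsConj P Q ∧ F.IsFullyAutomized p Q ∧ F.IsReceptive Q

/-- `P` is centric: `C_S(Q) ≤ Q` for every conjugate `Q` of `P`. -/
def IsCentric (F : FusionSystem S) (P : Subgroup S) : Prop :=
  ∀ Q : Subgroup S, F.IsConj P Q → Subgroup.centralizer (Q : Set S) ≤ Q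

/-- For a homomorphism `g : P → R` (and a subgroup `Q` of `P`), the condition `g(Q) = Q`. -/
def MapsOnto {P R : Subgroup S} (g : P →* R) (Q : Subgroup S) : Prop :=
  ∀ z : S, z ∈ Q ↔ ∃ y : P, (y : S) ∈ Q ∧ (g y : S) = z

/-- `Q` is normal in the fusion system: `Q` is normal in `S` and every morphism `f : P → R` extends
to a morphism `g : PQ → RQ` with `g(Q) = Q`. -/
def IsNormal (F : FusionSystem S) (Q : Subgroup S) : Prop :=
  Q.Normal ∧ ∀ (P R : Subgroup S), ∀ f ∈ F.hom P R, ∃ g ∈ F.hom (P ⊔ Q) (R ⊔ Q),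
    MapsOnto g Q ∧ ∀ (x : P) (y : ↥(P ⊔ Q)), (y : S) = x → (g y : S) = f x

/-- A fusion system is constrained if it is saturated and has a normal centric subgroup. -/
def IsConstrained (F : FusionSystem S) (p : ℕ) : Prop :=
  F.IsSaturated p ∧ ∃ Q : Subgroup S, F.IsNormal Q ∧ F.IsCentric Q

/-- The normalizer `N_F(Q)`: the fusion system over `N_S(Q)` whose morphisms `P → R` are the
morphisms in `F` which extend to some `g : PQ → RQ` in `F` with `g(Q) = Q`. -/
def normalizer (F : FusionSystem S) (Q : Subgroup S) :
    FusionSystem (Subgroup.normalizer (Q : Set S)) where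
  hom P R := {f | ∃ g ∈ F.hom (P.map (Subgroup.subtype _) ⊔ Q) (R.map (Subgroup.subtype _) ⊔ Q),
    MapsOnto g Q ∧ ∀ (x : P) (y : ↥(P.map (Subgroup.subtype _) ⊔ Q)),
      (y : S) = (x : Subgroup.normalizer (Q : Set S)) →
      (g y : S) = (f x : Subgroup.normalizer (Q : Set S))}
  injective_of_mem := by
    rintro P R f ⟨g, hg, -, hgf⟩ x y hxy
    have hx : ((x : Subgroup.normalizer (Q : Set S)) : S) ∈ P.map (Subgroup.subtype _) ⊔ Q :=
      Subgroup.mem_sup_left ⟨x, x.2, rfl⟩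
    have hy : ((y : Subgroup.normalizer (Q : Set S)) : S) ∈ P.map (Subgroup.subtype _) ⊔ Q :=
      Subgroup.mem_sup_left ⟨y, y.2, rfl⟩
    have h : g ⟨_, hx⟩ = g ⟨_, hy⟩ := by
      apply Subtype.ext
      rw [hgf x ⟨_, hx⟩ rfl, hgf y ⟨_, hy⟩ rfl, hxy]
    have h' := F.injective_of_mem hg h
    exact Subtype.ext (Subtype.ext (Subtype.mk.inj h'))
  conj_mem := by
    intro P R f s hf
    have hs : ∀ y ∈ P.map (Subgroup.subtype (Subgroup.normalizer (Q : Set S))) ⊔ Q,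
        (s : S) * y * (s : S)⁻¹ ∈ R.map (Subgroup.subtype _) ⊔ Q := by
      intro y hy
      suffices h : P.map (Subgroup.subtype _) ⊔ Q ≤
          (R.map (Subgroup.subtype _) ⊔ Q).comap (MulAut.conj (s : S)).toMonoidHom from h hy
      refine sup_le ?_ ?_
      · rintro _ ⟨x, hx, rfl⟩
        refine Subgroup.mem_sup_left ⟨f ⟨x, hx⟩, (f ⟨x, hx⟩).2, ?_⟩
        exact congrArg Subtype.val (hf ⟨x, hx⟩)
      · intro x hx
        exact Subgroup.mem_sup_right ((s.2 x).1 hx)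
    refine ⟨((MulAut.conj (s : S)).toMonoidHom.comp (Subgroup.subtype _)).codRestrict _
      (fun y => hs y y.2), F.conj_mem _ s (fun _ => rfl), ?_, ?_⟩
    · intro z
      constructor
      · intro hz
        have hz' : (s : S)⁻¹ * z * s ∈ Q := by
          refine (s.2 _).2 ?_
          simpa [mul_assoc] using hz
        refine ⟨⟨_, Subgroup.mem_sup_right hz'⟩, hz', ?_⟩
        change (s : S) * ((s : S)⁻¹ * z * s) * (s : S)⁻¹ = z
        group
      · rintro ⟨y, hy, rfl⟩
        exact (s.2 _).1 hy
    · intro x y hxy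
      change (s : S) * y * (s : S)⁻¹ = _
      rw [hf x, hxy]
      rfl
  comp_mem := by
    rintro P R T f f' ⟨g, hg, hgQ, hgf⟩ ⟨g', hg', hgQ', hgf'⟩
    refine ⟨g'.comp g, F.comp_mem hg hg', ?_, ?_⟩
    · intro z
      rw [hgQ' z]
      constructor
      · rintro ⟨y, hy, rfl⟩
        obtain ⟨w, hw, hwy⟩ := (hgQ y).1 hy
        exact ⟨w, hw, by rw [MonoidHom.comp_apply, Subtype.ext hwy]⟩
      · rintro ⟨w, hw, rfl⟩
        exact ⟨g w, (hgQ _).2 ⟨w, hw, rfl⟩, rfl⟩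
    · intro x y hxy
      exact hgf' (f x) (g y) (hgf x y hxy)
  iso_mem := by
    rintro P R T f e ⟨g, hg, hgQ, hgf⟩ he
    have h1 : ∀ y : ↥(P.map (Subgroup.subtype _) ⊔ Q),
        ((g y : _) : S) ∈ T.map (Subgroup.subtype _) ⊔ Q := by
      suffices h : P.map (Subgroup.subtype _) ⊔ Q ≤
          ((T.map (Subgroup.subtype _) ⊔ Q).comap ((Subgroup.subtype _).comp g)).map
            (Subgroup.subtype _) by
        intro y
        obtain ⟨w, hw, hwy⟩ := h y.2
        rwa [← Subtype.ext hwy]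
      refine sup_le ?_ ?_
      · rintro _ ⟨x, hx, rfl⟩
        have hx' := Subgroup.mem_sup_left (T := Q)
          (Subgroup.mem_map_of_mem (Subgroup.subtype (Subgroup.normalizer (Q : Set S))) hx)
        refine ⟨⟨_, hx'⟩, Subgroup.mem_sup_left ⟨e ⟨x, hx⟩, (e ⟨x, hx⟩).2, ?_⟩, rfl⟩
        exact (congrArg Subtype.val (he ⟨x, hx⟩)).trans (hgf ⟨x, hx⟩ ⟨_, hx'⟩ rfl).symm
      · intro x hx
        exact ⟨⟨x, Subgroup.mem_sup_right hx⟩,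
          Subgroup.mem_sup_right ((hgQ _).2 ⟨_, hx, rfl⟩), rfl⟩
    have h2 : T.map (Subgroup.subtype _) ⊔ Q ≤ ((Subgroup.subtype _).comp g).range := by
      refine sup_le ?_ ?_
      · rintro _ ⟨t, ht, rfl⟩
        obtain ⟨x, hx⟩ := e.surjective ⟨t, ht⟩
        refine ⟨⟨_, Subgroup.mem_sup_left (Subgroup.mem_map_of_mem _ x.2)⟩, ?_⟩
        refine (hgf x _ rfl).trans ?_
        rw [← he x, hx]
        rfl
      · intro z hz
        obtain ⟨y, -, rfl⟩ := (hgQ z).1 hz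
        exact ⟨y, rfl⟩
    let g' : ↥(P.map (Subgroup.subtype _) ⊔ Q) →* ↥(T.map (Subgroup.subtype _) ⊔ Q) :=
      ((Subgroup.subtype _).comp g).codRestrict _ h1
    let e' := MulEquiv.ofBijective g' ⟨by
        intro x y hxy
        have h' : ((g' x : _) : S) = g' y := by rw [hxy]
        exact F.injective_of_mem hg (Subtype.ext h'), by
        intro z
        obtain ⟨y, hy⟩ := h2 z.2
        exact ⟨y, Subtype.ext hy⟩⟩
    have he' : ∀ y, (e' y : S) = g y := fun _ => rfl
    obtain ⟨h3, h4⟩ := F.iso_mem e' hg he'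
    refine ⟨⟨_, h3, hgQ, ?_⟩, ⟨_, h4, ?_, ?_⟩⟩
    · intro x y hxy
      exact (hgf x y hxy).trans (congrArg Subtype.val (he x)).symm
    · intro z
      constructor
      · intro hz
        refine ⟨e' ⟨z, Subgroup.mem_sup_right hz⟩, (hgQ _).2 ⟨_, hz, rfl⟩, ?_⟩
        change ((e'.symm (e' _) : _) : S) = z
        rw [MulEquiv.symm_apply_apply]
      · rintro ⟨y, hy, rfl⟩
        obtain ⟨w, rfl⟩ := e'.surjective y
        change ((e'.symm (e' _) : _) : S) ∈ Q
        rw [MulEquiv.symm_apply_apply]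
        obtain ⟨w', hw', hww'⟩ := (hgQ _).1 hy
        rwa [← F.injective_of_mem hg (Subtype.ext (hww'.trans (he' w)))]
    · intro x y hxy
      obtain ⟨x, rfl⟩ := e.surjective x
      obtain ⟨y, rfl⟩ := e'.surjective y
      change ((e'.symm (e' _) : _) : S) = ((e.symm (e x) : P) : Subgroup.normalizer (Q : Set S))
      rw [MulEquiv.symm_apply_apply, MulEquiv.symm_apply_apply]
      have hx' := Subgroup.mem_sup_left (T := Q)
          (Subgroup.mem_map_of_mem (Subgroup.subtype (Subgroup.normalizer (Q : Set S))) x.2)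
      have h5 : g y = g ⟨_, hx'⟩ := by
        apply Subtype.ext
        rw [← he' y, hxy, hgf x _ rfl, he x]
      rw [F.injective_of_mem hg h5]
      rfl

/-- A fusion system over a finite `p`-group is of characteristic `p`-type if it is saturated and the
normalizer of each nontrivial fully normalized subgroup is constrained. -/
def IsOfCharacteristicPType (F : FusionSystem S) (p : ℕ) : Prop :=
  F.IsSaturated p ∧
    ∀ Q : Subgroup S, Q ≠ ⊥ → F.IsFullyNormalized Q → (F.normalizer Q).IsConstrained p

end FusionSystem

/-! ### The groups -/

/-- `O^{p'}(G)` for a finite group `G`: the subgroup generated by the Sylow `p`-subgroups. -/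
def pPrimeResidual (p : ℕ) (G : Type u) [Group G] : Subgroup G := ⨆ P : Sylow p G, (P : Subgroup G)

namespace ClellandParker

open Matrix MvPolynomial

section

variable (k : Type u) [Field k]

/-- `A(n,k)`: homogeneous polynomials of degree `n` in two variables. -/
abbrev A (n : ℕ) : Type u := ↥(homogeneousSubmodule (Fin 2) k n)

/-- `D = kˣ × GL₂(k)`. -/
abbrev D : Type u := kˣ × GL (Fin 2) k

variable {k}

/-- The linear substitution `x_j ↦ ∑ i, M i j • x_i`. -/
noncomputable def subst (M : Matrix (Fin 2) (Fin 2) k) :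
    MvPolynomial (Fin 2) k →ₐ[k] MvPolynomial (Fin 2) k :=
  aeval fun j => ∑ i, C (M i j) * X i

theorem subst_one : subst (1 : Matrix (Fin 2) (Fin 2) k) = AlgHom.id k _ := by
  ext j : 1
  fin_cases j <;> simp [subst]

theorem subst_mul (M N : Matrix (Fin 2) (Fin 2) k) :
    subst (M * N) = (subst M).comp (subst N) := by
  ext j : 1
  simp only [subst, aeval_X, AlgHom.comp_apply, map_mul, Matrix.mul_apply, Fin.sum_univ_two,
    map_add, algHom_C, algebraMap_eq]
  ring

theorem subst_mem {n : ℕ} (M : Matrix (Fin 2) (Fin 2) k) {f : MvPolynomial (Fin 2) k}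
    (hf : f ∈ homogeneousSubmodule (Fin 2) k n) : subst M f ∈ homogeneousSubmodule (Fin 2) k n := by
  have h := (IsHomogeneous.aeval ((mem_homogeneousSubmodule n f).1 hf)
    (fun j => ∑ i, C (M i j) * X i) (n := 1) (fun j => IsHomogeneous.sum _ _ _ fun i _ => by
      simpa using (isHomogeneous_C (Fin 2) (M i j)).mul (isHomogeneous_X k i)))
  rw [one_mul] at h
  exact h

variable (k)

/-- The action of `D` on `A(n,k)`: the pair `(t, M)` acts as the substitution by `M` followed by
multiplication by the scalar `t`. -/
noncomputable def rep (n : ℕ) : Representation k (D k) (A k n) where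
  toFun d := (d.1 : k) • ((subst (d.2 : Matrix (Fin 2) (Fin 2) k)).toLinearMap.restrict
    (fun _ hf => subst_mem _ hf))
  map_one' := by
    ext f
    simp [subst_one]
  map_mul' d e := by
    apply LinearMap.ext
    intro f
    apply Subtype.ext
    change ((d.1 * e.1 : kˣ) : k) • subst ((d.2 * e.2 : GL (Fin 2) k) : Matrix _ _ k) (f : _) =
      (d.1 : k) • subst (d.2 : Matrix _ _ k) ((e.1 : k) • subst (e.2 : Matrix _ _ k) (f : _))
    rw [map_smul, Units.val_mul, Units.val_mul, subst_mul, mul_smul, AlgHom.comp_apply]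

/-- The action of `D` on `A(n,k)` by group automorphisms, the group `A(n,k)` being written
multiplicatively. -/
noncomputable def act (n : ℕ) : D k →* MulAut (Multiplicative (A k n)) where
  toFun d := AddEquiv.toMultiplicative
    { toFun := rep k n d
      invFun := rep k n d⁻¹
      left_inv := fun f => by
        rw [← Module.End.mul_apply, ← map_mul, inv_mul_cancel, map_one, Module.End.one_apply]
      right_inv := fun f => by
        rw [← Module.End.mul_apply, ← map_mul, mul_inv_cancel, map_one, Module.End.one_apply]
      map_add' := fun f g => map_add _ f g }
  map_one' := by
    ext f : 1
    exact congrArg Multiplicative.ofAdd (by simp : rep k n 1 f.toAdd = f.toAdd)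
  map_mul' d e := by
    ext f : 1
    exact congrArg Multiplicative.ofAdd
      (by simp : rep k n (d * e) f.toAdd = rep k n d (rep k n e f.toAdd))

/-- The semidirect product `G = DA`. -/
abbrev G (n : ℕ) : Type u := Multiplicative (A k n) ⋊[act k n] D k

/-- The Sylow `p`-subgroup `U` of `D` (where `p` is the characteristic of the finite field `k`):
the pairs `(1, M)` with `M` upper unitriangular. -/
def U : Subgroup (D k) where
  carrier := {d | d.1 = 1 ∧ d.2 0 0 = 1 ∧ d.2 1 0 = 0 ∧ d.2 1 1 = 1}
  one_mem' := by simp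
  mul_mem' := by
    rintro a b ⟨a1, a2, a3, a4⟩ ⟨b1, b2, b3, b4⟩
    simp [Matrix.mul_apply, Fin.sum_univ_two, a1, a2, a3, a4, b1, b2, b3, b4]
  inv_mem' := by
    rintro a ⟨a1, a2, a3, a4⟩
    simp [a1, a2, a3, a4, Matrix.inv_def, Matrix.det_fin_two, Matrix.adjugate_fin_two]

/-- The Sylow `p`-subgroup `S = S(n,k) = UA` of `G`. -/
noncomputable def S (n : ℕ) : Subgroup (G k n) := (U k).comap SemidirectProduct.rightHom

/-- The center `Z = Z(S)`, as a subgroup of `G`. -/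
noncomputable def Z (n : ℕ) : Subgroup (G k n) := (Subgroup.center (S k n)).map (S k n).subtype

/-- `R = ZU`. -/
noncomputable def R (n : ℕ) : Subgroup (G k n) := Z k n ⊔ (U k).map SemidirectProduct.inr

/-- `N_G(R)`. -/
noncomputable abbrev NR (n : ℕ) : Subgroup (G k n) := Subgroup.normalizer (R k n : Set (G k n))

/-- `H_R`: the stabilizer in `GL₃(k)` of the line spanned by the first standard basis vector. -/
def H : Subgroup (GL (Fin 3) k) where
  carrier := {g | ∃ c : k, (g : Matrix (Fin 3) (Fin 3) k) *ᵥ Pi.single 0 1 = c • Pi.single 0 1}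
  one_mem' := ⟨1, by rw [Units.val_one, Matrix.one_mulVec, one_smul]⟩
  mul_mem' := by
    rintro a b ⟨c, hc⟩ ⟨d, hd⟩
    refine ⟨d * c, ?_⟩
    rw [Units.val_mul, ← Matrix.mulVec_mulVec, hd, Matrix.mulVec_smul, hc, smul_smul]
  inv_mem' := by
    rintro a ⟨c, hc⟩
    have h1 : (Pi.single 0 1 : Fin 3 → k) =
        c • ((a⁻¹ : GL (Fin 3) k) : Matrix (Fin 3) (Fin 3) k) *ᵥ Pi.single 0 1 := by
      rw [← Matrix.mulVec_smul, ← hc, Matrix.mulVec_mulVec, ← Units.val_mul, inv_mul_cancel,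
        Units.val_one, Matrix.one_mulVec]
    have hc0 : c ≠ 0 := by
      rintro rfl
      simpa using congrFun h1 0
    exact ⟨c⁻¹, by conv_rhs => rw [h1, smul_smul, inv_mul_cancel₀ hc0, one_smul]⟩

/-- The Borel subgroup of `GL₃(k)` of upper triangular matrices. -/
def Borel : Subgroup (GL (Fin 3) k) where
  carrier := {g | (g : Matrix (Fin 3) (Fin 3) k).BlockTriangular id}
  one_mem' := by simpa using Matrix.blockTriangular_one
  mul_mem' := fun ha hb => by simpa using Matrix.BlockTriangular.mul ha hb
  inv_mem' := fun {a} ha => by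
    have : Invertible (a : Matrix (Fin 3) (Fin 3) k) := a.invertible
    simpa using Matrix.blockTriangular_inv_of_blockTriangular ha

theorem Borel_le_H : Borel k ≤ H k := by
  intro g hg
  refine ⟨g 0 0, ?_⟩
  ext i
  rw [Matrix.mulVec_single_one, Matrix.col_apply]
  by_cases hi : i = 0
  · subst hi
    simp
  · have h : (0 : Fin 3) < i := Fin.pos_of_ne_zero hi
    simpa [hi] using hg h

/-- The unipotent radical of `H_R`: the elements of `GL₃(k)` which act trivially both on the line
stabilized by `H_R` and on the quotient of `k³` by this line. -/
def unipotentRadical : Subgroup (GL (Fin 3) k) where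
  carrier := {g | (g : Matrix (Fin 3) (Fin 3) k) *ᵥ Pi.single 0 1 = Pi.single 0 1 ∧
    ∀ v, ∃ c : k, (g : Matrix (Fin 3) (Fin 3) k) *ᵥ v = v + c • Pi.single 0 1}
  one_mem' := by
    refine ⟨by rw [Units.val_one, Matrix.one_mulVec], fun v => ⟨0, ?_⟩⟩
    rw [Units.val_one, Matrix.one_mulVec, zero_smul, add_zero]
  mul_mem' := by
    rintro a b ⟨ha, ha'⟩ ⟨hb, hb'⟩
    refine ⟨by rw [Units.val_mul, ← Matrix.mulVec_mulVec, hb, ha], fun v => ?_⟩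
    obtain ⟨c, hc⟩ := hb' v
    obtain ⟨d, hd⟩ := ha' v
    refine ⟨d + c, ?_⟩
    rw [Units.val_mul, ← Matrix.mulVec_mulVec, hc, Matrix.mulVec_add, Matrix.mulVec_smul, ha, hd,
      add_smul, add_assoc]
  inv_mem' := by
    rintro a ⟨ha, ha'⟩
    have key : ∀ v w, (a : Matrix (Fin 3) (Fin 3) k) *ᵥ v = w →
        ((a⁻¹ : GL (Fin 3) k) : Matrix (Fin 3) (Fin 3) k) *ᵥ w = v := by
      rintro v w rfl
      rw [Matrix.mulVec_mulVec, ← Units.val_mul, inv_mul_cancel, Units.val_one, Matrix.one_mulVec]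
    refine ⟨key _ _ ha, fun v => ?_⟩
    obtain ⟨c, hc⟩ := ha' v
    refine ⟨-c, key _ _ ?_⟩
    rw [Matrix.mulVec_add, Matrix.mulVec_smul, ha, hc, neg_smul, add_neg_cancel_right]

/-- The two factors of the free amalgamated product: `G` (index `false`) and `H_R` (index
`true`). -/
def Factor (n : ℕ) : Bool → Type u
  | false => G k n
  | true => H k

noncomputable instance (n : ℕ) : ∀ b, Group (Factor k n b)
  | false => inferInstanceAs (Group (G k n))
  | true => inferInstanceAs (Group (H k))

variable {k}

/-- The embeddings of `N_G(R)` into the two factors, given an identification `φ` of `N_G(R)` with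
the Borel subgroup of `GL₃(k)`. (For `1 ≤ n ≤ p - 1`, the group `N_G(R)` consists of the pairs
`(v, (t, M))` with `M` upper triangular with diagonal entries `α, δ` and with
`v = a x₀ⁿ + b x₀ⁿ⁻¹ x₁`. One identification, which carries `R` to the unipotent radical of `H_R`,
sends such an element to the upper triangular matrix with upper left block `M`, last diagonal entry
`s = (t αⁿ⁻¹)⁻¹`, and last column `(s a, s b, s)`.) -/
noncomputable def factorMap {n : ℕ} (φ : NR k n ≃* Borel k) : ∀ b, NR k n →* Factor k n b
  | false => (NR k n).subtype
  | true => (Subgroup.inclusion (Borel_le_H k)).comp φ.toMonoidHom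

/-- The free amalgamated product `F(1,n,k,R) = G *_{N_G(R)} H_R`. -/
abbrev Amalgam {n : ℕ} (φ : NR k n ≃* Borel k) : Type u := Monoid.PushoutI (factorMap φ)

/-- The canonical map from `G` to the amalgamated product. -/
noncomputable def ofG {n : ℕ} (φ : NR k n ≃* Borel k) : G k n →* Amalgam φ :=
  Monoid.PushoutI.of (φ := factorMap φ) false

/-- The canonical map from `H_R` to the amalgamated product. -/
noncomputable def ofH {n : ℕ} (φ : NR k n ≃* Borel k) : H k →* Amalgam φ :=
  Monoid.PushoutI.of (φ := factorMap φ) true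

/-- The fusion system `F_S(M)` over `S` of a subgroup `M` of the amalgamated product containing `S`
(more precisely, containing the isomorphic image of `S`). -/
noncomputable def fusionSystem {n : ℕ} (φ : NR k n ≃* Borel k) (M : Subgroup (Amalgam φ)) :
    FusionSystem (((S k n).map (ofG φ)).subgroupOf M) :=
  groupFusionSystem (((S k n).map (ofG φ)).subgroupOf M)

end

end ClellandParker

/-!
Let `Γ` be the amalgamated product, `B = N_G(R)` its amalgamated subgroup, and call an element of
`p`-power order a `p`-element. Both parts of the claim follow from a description of the normalizers
in `Γ` of the nontrivial subgroups `Q` of `S` (`HasGoodNormalizer`): `N_Γ(Q)` is finite, its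
`p`-subgroups are conjugate into `S`, and it has a normal `p`-subgroup containing all `p`-elements
by which it is centralized.

*From normalizers to fusion.* If the fusion system is realized by `M` and `N_M(Q)` is finite with
Sylow subgroup `N_S(Q)`, then `Q` is fully automized (images of Sylow subgroups are Sylow) and
receptive (Sylow's theorem in the group of those elements of `N_M(Q)` which act on `Q` as an element
of `N_S(Q)` does). Every nontrivial subgroup is conjugate to such a `Q`, and a nontrivial fully
normalized subgroup is such a `Q` by comparison of orders, so that its normalizer system is the
fusion system of the finite group `N_M(Q)`; see `IsRealizedBy.isOfCharacteristicPType`.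

*Normalizers in `Γ`.* One shows that, up to conjugacy, `N_Γ(Q)` lies in a factor. This is an
argument about the subtree fixed by `Q` in the Bass-Serre tree, carried out with reduced words: by
`AltWord.mem_base_of_conj_mem` an element of a factor whose conjugate by a reduced word starting in
the other factor lies in a factor belongs to `B`. A `p`-element of `B` outside `R` fixes only one
edge at the vertex `H_R`, an element of `R \ Z` lies in only one of the conjugates of `R` in `G`,
and distinct `H_R`-conjugates of `Z` intersect trivially, since `R` is a natural module for `GL₂(k)`
with `Z` as a line. It follows that `N_Γ(Q) ≤ G` if no `G`-conjugate of `Q` lies in `R`, or if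
`Q ≤ Z`, and that `N_Γ(Q) ≤ H_R` if `Q ≤ R` and no `H_R`-conjugate of `Q` lies in `Z`. In `H_R` the
normal `p`-subgroup wanted is `R`; in `G` it is `A` if `Q ≤ A` and `Q C_S(Q)` otherwise. The bound
`n < p` enters through the fact that a nontrivial element of `U` has a single Jordan block on `A`:
a polynomial of degree less than `p` invariant under a translation is constant.

*From `Γ` to `M`.* The group generated by `O^{p'}(G)` and `O^{p'}(H_R)` is normal in `Γ` and
supplemented by `B` (Frattini argument in both factors). As `B` normalizes `S`, all `p`-subgroups
which are conjugate into `S` lie in this group, and hence in `M`, and are conjugate into `S` by its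
elements (`exists_residual_conj`).
-/

/-! ### Saturation and constraint from normalizers in a realizing group -/

namespace FusionSystem

section Realization

variable {S Γ : Type u} [Group S] [Group Γ]

/-- The fusion system `F` over `S` is realized by the subgroup `M` of `Γ`: after identifying `S`
with a subgroup of `M` by means of the injective homomorphism `ι`, the morphisms of `F` are exactly
the maps induced by conjugation by elements of `M`. -/
structure IsRealizedBy (F : FusionSystem S) (ι : S →* Γ) (M : Subgroup Γ) : Prop where
  injective : Function.Injective ι
  mem : ∀ s, ι s ∈ M
  mem_hom_iff : ∀ {P Q : Subgroup S} (f : P →* Q),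
    f ∈ F.hom P Q ↔ ∃ g ∈ M, ∀ x : P, ι (f x) = g * ι x * g⁻¹

theorem mem_extensionDomain_iff {Q P : Subgroup S} (e : Q ≃* P) (s : S) :
    s ∈ extensionDomain e ↔ s ∈ Subgroup.normalizer (Q : Set S) ∧
      ∃ t ∈ Subgroup.normalizer (P : Set S), ∀ (x y : Q), (y : S) = s * x * s⁻¹ →
        (e y : S) = t * e x * t⁻¹ := by
  rw [extensionDomain]
  constructor
  · rintro ⟨⟨s, hs⟩, ⟨⟨t, ht⟩, hts⟩, rfl⟩
    refine ⟨hs, t, ht, fun x y hy => ?_⟩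
    have h := DFunLike.congr_fun hts (e x)
    have hy' : y = Q.normalizerMonoidHom ⟨s, hs⟩ x := Subtype.ext hy
    simp only [MonoidHom.comp_apply, MulEquiv.coe_toMonoidHom, MulAut.congr_apply,
      MulEquiv.trans_apply, MulEquiv.symm_apply_apply] at h
    rw [hy', ← h]
    rfl
  · rintro ⟨hs, t, ht, h⟩
    refine ⟨⟨s, hs⟩, ⟨⟨t, ht⟩, ?_⟩, rfl⟩
    ext z
    obtain ⟨x, rfl⟩ := e.surjective z
    simp only [MonoidHom.comp_apply, MulEquiv.coe_toMonoidHom, MulAut.congr_apply,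
      MulEquiv.trans_apply, MulEquiv.symm_apply_apply]
    exact (h x _ rfl).symm

theorem mem_autBy_iff {P : Subgroup S} (a : MulAut P) :
    a ∈ autBy P ↔ ∃ t ∈ Subgroup.normalizer (P : Set S), ∀ x : P, (a x : S) = t * x * t⁻¹ := by
  constructor
  · rintro ⟨⟨t, ht⟩, rfl⟩
    exact ⟨t, ht, fun _ => rfl⟩
  · rintro ⟨t, ht, h⟩
    exact ⟨⟨t, ht⟩, MulEquiv.ext fun x => Subtype.ext (h x).symm⟩

theorem mem_normalizer_map_iff {ι : S →* Γ} (hι : Function.Injective ι) (Q : Subgroup S) (s : S) :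
    ι s ∈ Subgroup.normalizer ((Q.map ι : Subgroup Γ) : Set Γ) ↔
      s ∈ Subgroup.normalizer (Q : Set S) := by
  simp only [Subgroup.mem_normalizer_iff]
  constructor
  · intro h x
    have := h (ι x)
    rwa [← map_inv, ← map_mul, ← map_mul, Subgroup.mem_map_iff_mem hι,
      Subgroup.mem_map_iff_mem hι] at this
  · intro h x
    constructor
    · rintro ⟨x, hx, rfl⟩
      exact ⟨s * x * s⁻¹, (h x).1 hx, by simp⟩
    · rintro ⟨y, hy, hyx⟩
      refine ⟨s⁻¹ * y * s, (h _).2 (by simpa [mul_assoc] using hy), ?_⟩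
      rw [map_mul, map_mul, hyx, map_inv]
      group

/-- The subgroup `T` of `M` is a Sylow `p`-subgroup of `M`. -/
def IsSylowIn (p : ℕ) (T M : Subgroup Γ) : Prop :=
  T ≤ M ∧ ∃ P : Sylow p M, (P : Subgroup M) = T.subgroupOf M

/-- If a subgroup of `M` containing the Sylow subgroup `T` also contains the `p`-group `V`, then one
of its elements conjugates `V` into `T`. -/
theorem IsSylowIn.exists_conj {p : ℕ} [Fact p.Prime] {T M : Subgroup Γ} (h : IsSylowIn p T M)
    (hM : Finite M) {K V : Subgroup Γ} (hKM : K ≤ M) (hTK : T ≤ K) (hV : IsPGroup p V)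
    (hVK : V ≤ K) : ∃ g ∈ K, ∀ v ∈ V, g * v * g⁻¹ ∈ T := by
  obtain ⟨hTM, P, hP⟩ := h
  have hK : Finite K := Finite.of_injective _ (Subgroup.inclusion_injective hKM)
  have hPK : (P : Subgroup M) ≤ K.subgroupOf M := by
    rw [hP]
    exact Subgroup.comap_mono hTK
  let P' : Sylow p K := (P.subtype hPK).comapOfInjective
    ((Subgroup.subgroupOfEquivOfLe hKM).symm.toMonoidHom)
    (Subgroup.subgroupOfEquivOfLe hKM).symm.injective (by
      rw [MonoidHom.range_eq_top.2 (Subgroup.subgroupOfEquivOfLe hKM).symm.surjective]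
      exact le_top)
  have hP' : ∀ x : K, x ∈ P' ↔ (x : Γ) ∈ T := by
    intro x
    have : x ∈ P' ↔ (⟨x, hKM x.2⟩ : M) ∈ (P : Subgroup M) := Iff.rfl
    rw [this, hP]
    rfl
  have hVK' : IsPGroup p (V.subgroupOf K) := hV.comap_subtype
  obtain ⟨Q, hQ⟩ := hVK'.exists_le_sylow
  obtain ⟨g, hg⟩ := MulAction.exists_smul_eq K Q P'
  refine ⟨g, g.2, fun v hv => ?_⟩
  have h1 : g * ⟨v, hVK hv⟩ * g⁻¹ ∈ P' := by
    rw [← hg]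
    exact Subgroup.smul_mem_pointwise_smul _ (MulAut.conj g) _ (hQ hv)
  exact (hP' _).1 h1

theorem isPGroup_of_le {p : ℕ} {V W : Subgroup Γ} (hW : IsPGroup p W) (h : V ≤ W) :
    IsPGroup p V :=
  hW.of_injective (Subgroup.inclusion h) (Subgroup.inclusion_injective h)

theorem exists_hom_of_conj {ι : S →* Γ} (hι : Function.Injective ι) (g : Γ) {P Q : Subgroup S}
    (h : ∀ x ∈ P, ∃ y ∈ Q, ι y = g * ι x * g⁻¹) :
    ∃ f : P →* Q, ∀ x : P, ι (f x) = g * ι x * g⁻¹ := by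
  choose y hyQ hy using h
  let f₀ : P →* S :=
    { toFun := fun s => y s s.2
      map_one' := hι (by rw [hy, map_one]; simp)
      map_mul' := fun a b => hι (by
        rw [hy, map_mul, hy, hy, Subgroup.coe_mul, map_mul]; group) }
  exact ⟨f₀.codRestrict Q fun x => hyQ x x.2, fun x => hy x x.2⟩

variable {F : FusionSystem S} {ι : S →* Γ} {M : Subgroup Γ}

/-- The normalizer in `M` of the image of `Q`. -/
abbrev normalizerIn (ι : S →* Γ) (M : Subgroup Γ) (Q : Subgroup S) : Subgroup Γ :=
  M ⊓ Subgroup.normalizer ((Q.map ι : Subgroup Γ) : Set Γ)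

/-- Conjugation maps the normalizer of `Q` in `M` onto `Aut_F(Q)`. -/
theorem IsRealizedBy.exists_conjHom (hF : F.IsRealizedBy ι M) (Q : Subgroup S) :
    ∃ π : normalizerIn ι M Q →* F.aut Q, Function.Surjective π ∧
      ∀ g x, ι ((π g : MulAut Q) x) = g * ι x * (g : Γ)⁻¹ := by
  let E := Q.equivMapOfInjective ι hF.injective
  let π₀ : normalizerIn ι M Q →* MulAut Q := (MulAut.congr E.symm).toMonoidHom.comp
    ((Q.map ι).normalizerMonoidHom.comp (Subgroup.inclusion inf_le_right))
  have h0 : ∀ g x, ι (π₀ g x) = g * ι x * (g : Γ)⁻¹ := by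
    intro g x
    have h1 : ∀ z : Q, ι z = (E z : Γ) := fun _ => rfl
    rw [h1]
    simp only [π₀, MonoidHom.comp_apply, MulEquiv.coe_toMonoidHom, MulAut.congr_apply,
      MulEquiv.trans_apply, MulEquiv.symm_symm, MulEquiv.apply_symm_apply]
    rfl
  refine ⟨π₀.codRestrict (F.aut Q) fun g => (hF.mem_hom_iff _).2 ⟨g, g.2.1, h0 g⟩, ?_, h0⟩
  rintro ⟨a, ha⟩
  obtain ⟨g, hgM, hg⟩ := (hF.mem_hom_iff _).1 ha
  have hgn : g ∈ Subgroup.normalizer ((Q.map ι : Subgroup Γ) : Set Γ) := by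
    rw [Subgroup.mem_normalizer_iff]
    intro y
    constructor
    · rintro ⟨x, hx, rfl⟩
      exact ⟨a ⟨x, hx⟩, (a ⟨x, hx⟩).2, hg ⟨x, hx⟩⟩
    · rintro ⟨x, hx, hxy⟩
      obtain ⟨z, hz⟩ := a.surjective ⟨x, hx⟩
      refine ⟨z, z.2, ?_⟩
      have := hg z
      change ι (a z : S) = _ at this
      rw [hz] at this
      rw [show ι x = _ from this] at hxy
      exact mul_left_cancel (mul_right_cancel hxy)
  refine ⟨⟨g, hgM, hgn⟩, Subtype.ext (MulEquiv.ext fun x => Subtype.ext (hF.injective ?_))⟩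
  exact (h0 _ x).trans (hg x).symm

/-- The image of `N_S(Q)` is a Sylow `p`-subgroup of the finite group `N_M(Q)`. -/
structure HasSylowNormalizer (p : ℕ) (ι : S →* Γ) (M : Subgroup Γ) (Q : Subgroup S) : Prop where
  finite : Finite (normalizerIn ι M Q)
  isSylowIn : IsSylowIn p ((Subgroup.normalizer (Q : Set S)).map ι) (normalizerIn ι M Q)

theorem IsRealizedBy.isFullyAutomized {p : ℕ} [Fact p.Prime] (hF : F.IsRealizedBy ι M)
    {Q : Subgroup S} (hQ : HasSylowNormalizer p ι M Q) : F.IsFullyAutomized p Q := by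
  obtain ⟨π, hπ, hπx⟩ := hF.exists_conjHom Q
  obtain ⟨hfin, hle, P, hP⟩ := hQ
  refine ⟨P.mapSurjective hπ, ?_⟩
  ext a
  rw [Sylow.coe_mapSurjective, hP, Subgroup.mem_subgroupOf, mem_autBy_iff]
  constructor
  · rintro ⟨g, ⟨t, ht, htg⟩, rfl⟩
    refine ⟨t, ht, fun x => hF.injective ?_⟩
    rw [hπx, ← show ι t = g from htg]
    simp
  · rintro ⟨t, ht, h⟩
    refine ⟨⟨ι t, hle ⟨t, ht, rfl⟩⟩, ⟨t, ht, rfl⟩,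
      Subtype.ext (MulEquiv.ext fun x => Subtype.ext (hF.injective ?_))⟩
    rw [hπx, h]
    simp

open scoped Pointwise in
/-- The extension to `N_e` is found by conjugating the image of `N_e` into `N_S(P)` by an element
which centralizes `P`. -/
theorem IsRealizedBy.isReceptive {p : ℕ} [Fact p.Prime] (hS : IsPGroup p S)
    (hF : F.IsRealizedBy ι M) {P : Subgroup S} (hP : HasSylowNormalizer p ι M P) :
    F.IsReceptive P := by
  intro Q e he
  obtain ⟨g, hgM, hg⟩ := (hF.mem_hom_iff _).1 he
  change ∀ x : Q, ι (e x) = g * ι x * g⁻¹ at hg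
  -- `K` consists of the elements of `N_M(P)` acting on `P` as an element of `N_S(P)` does
  let K : Subgroup Γ := ((Subgroup.normalizer (P : Set S)).map ι) ⊔
    (M ⊓ Subgroup.centralizer ((P.map ι : Subgroup Γ) : Set Γ))
  have hcent : Subgroup.centralizer ((P.map ι : Subgroup Γ) : Set Γ) ≤
      Subgroup.normalizer ((P.map ι : Subgroup Γ) : Set Γ) := Subgroup.centralizer_le_normalizer _
  have hKM : K ≤ normalizerIn ι M P := sup_le hP.isSylowIn.1 (inf_le_inf_left M hcent)
  have hmemK : ∀ k ∈ K, ∃ t ∈ Subgroup.normalizer (P : Set S), ∃ c ∈ M ⊓ Subgroup.centralizer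
      ((P.map ι : Subgroup Γ) : Set Γ), k = ι t * c := by
    intro k hk
    have hn : ((Subgroup.normalizer (P : Set S)).map ι) ≤ Subgroup.normalizer
        ((M ⊓ Subgroup.centralizer ((P.map ι : Subgroup Γ) : Set Γ) : Subgroup Γ) : Set Γ) := by
      rintro _ ⟨t, ht, rfl⟩
      have ht' := (mem_normalizer_map_iff hF.injective P t).2 ht
      have hconj : ∀ a ∈ Subgroup.normalizer ((P.map ι : Subgroup Γ) : Set Γ), a ∈ M →
          ∀ y ∈ M ⊓ Subgroup.centralizer ((P.map ι : Subgroup Γ) : Set Γ),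
          a * y * a⁻¹ ∈ M ⊓ Subgroup.centralizer ((P.map ι : Subgroup Γ) : Set Γ) := by
        rintro a ha haM y ⟨hyM, hy⟩
        refine Subgroup.mem_inf.2 ⟨M.mul_mem (M.mul_mem haM hyM) (M.inv_mem haM),
          Subgroup.mem_centralizer_iff.2 ?_⟩
        intro x hx
        have h1 := (Subgroup.mem_centralizer_iff.1 hy) (a⁻¹ * x * a) (by
          have := (Subgroup.mem_normalizer_iff.1 (Subgroup.inv_mem _ ha) x).1 hx
          simpa using this)
        calc x * (a * y * a⁻¹) = a * ((a⁻¹ * x * a) * y) * a⁻¹ := by group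
          _ = a * (y * (a⁻¹ * x * a)) * a⁻¹ := by rw [h1]
          _ = a * y * a⁻¹ * x := by group
      rw [Subgroup.mem_normalizer_iff]
      intro y
      refine ⟨hconj _ ht' (hF.mem t) y, fun hy => ?_⟩
      have := hconj _ (Subgroup.inv_mem _ ht') (M.inv_mem (hF.mem t)) _ hy
      simpa [mul_assoc] using this
    have hk' : k ∈ (((Subgroup.normalizer (P : Set S)).map ι) : Set Γ) *
        ((M ⊓ Subgroup.centralizer ((P.map ι : Subgroup Γ) : Set Γ) : Subgroup Γ) : Set Γ) := by
      rw [← Subgroup.coe_mul_of_left_le_normalizer_right _ _ hn]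
      exact hk
    obtain ⟨_, ⟨t, ht, rfl⟩, c, hc, rfl⟩ := hk'
    exact ⟨t, ht, c, hc, rfl⟩
  let V : Subgroup Γ := (extensionDomain e).map ((MulAut.conj g).toMonoidHom.comp ι)
  have hVP : IsPGroup p V := (hS.to_subgroup _).map _
  have hVK : V ≤ K := by
    rintro _ ⟨s, hs, rfl⟩
    obtain ⟨hsn, t, ht, hst⟩ := (mem_extensionDomain_iff e s).1 hs
    have hc : (ι t)⁻¹ * (g * ι s * g⁻¹) ∈
        M ⊓ Subgroup.centralizer ((P.map ι : Subgroup Γ) : Set Γ) := by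
      refine Subgroup.mem_inf.2 ⟨M.mul_mem (M.inv_mem (hF.mem t))
        (M.mul_mem (M.mul_mem hgM (hF.mem s)) (M.inv_mem hgM)), Subgroup.mem_centralizer_iff.2 ?_⟩
      rintro _ ⟨z, hz, rfl⟩
      obtain ⟨x, hx⟩ := e.surjective ⟨z, hz⟩
      have hxz : ι z = g * ι x * g⁻¹ := by rw [← hg, hx]
      have h1 := congrArg ι (hst x ⟨s * x * s⁻¹, (Subgroup.mem_normalizer_iff.1 hsn x).1 x.2⟩ rfl)
      rw [hg, hx] at h1
      simp only [map_mul, map_inv] at h1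
      have h2 : (g * ι s * g⁻¹) * ι z * (g * ι s * g⁻¹)⁻¹ = ι t * ι z * (ι t)⁻¹ := by
        rw [← h1, hxz]
        group
      calc ι z * ((ι t)⁻¹ * (g * ι s * g⁻¹))
          = (ι t)⁻¹ * (ι t * ι z * (ι t)⁻¹) * (g * ι s * g⁻¹) := by group
        _ = (ι t)⁻¹ * (g * ι s * g⁻¹) * ι z := by rw [← h2]; group
    have : (MulAut.conj g).toMonoidHom.comp ι s = ι t * ((ι t)⁻¹ * (g * ι s * g⁻¹)) := by
      simp
    rw [this]
    exact Subgroup.mul_mem_sup ⟨t, ht, rfl⟩ hc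
  obtain ⟨k, hk, hkV⟩ := hP.isSylowIn.exists_conj hP.finite hKM le_sup_left hVP hVK
  obtain ⟨t, ht, c, ⟨hcM, hc⟩, rfl⟩ := hmemK k hk
  have key : ∀ s ∈ extensionDomain e, ∃ y : S, ι y = c * g * ι s * (c * g)⁻¹ := by
    intro s hs
    obtain ⟨y, hy, hys⟩ := hkV _ ⟨s, hs, rfl⟩
    refine ⟨t⁻¹ * y * t, ?_⟩
    rw [map_mul, map_mul, hys, map_inv]
    simp only [MonoidHom.comp_apply, MulEquiv.coe_toMonoidHom, MulAut.conj_apply]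
    group
  obtain ⟨f, hf⟩ := exists_hom_of_conj hF.injective (c * g) (P := extensionDomain e) (Q := ⊤)
    fun s hs => let ⟨y, hy⟩ := key s hs; ⟨y, Subgroup.mem_top y, hy⟩
  refine ⟨f, (hF.mem_hom_iff _).2 ⟨c * g, M.mul_mem hcM hgM, hf⟩, fun x s hsx => ?_⟩
  refine hF.injective ((hf s).trans ?_)
  have h3 := Subgroup.mem_centralizer_iff.1 hc (ι (e x)) ⟨e x, (e x).2, rfl⟩
  rw [hsx]
  calc c * g * ι x * (c * g)⁻¹ = c * (g * ι x * g⁻¹) * c⁻¹ := by group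
    _ = ι (e x) := by rw [← hg, ← h3]; group

theorem IsRealizedBy.isConj_iff (hF : F.IsRealizedBy ι M) {P Q : Subgroup S} :
    F.IsConj P Q ↔ ∃ g ∈ M, Q.map ι = (P.map ι).map (MulAut.conj g).toMonoidHom := by
  constructor
  · rintro ⟨e, he⟩
    obtain ⟨g, hgM, hg⟩ := (hF.mem_hom_iff _).1 he
    change ∀ x : P, ι (e x) = g * ι x * g⁻¹ at hg
    refine ⟨g, hgM, le_antisymm ?_ ?_⟩
    · rintro _ ⟨y, hy, rfl⟩
      obtain ⟨x, hx⟩ := e.surjective ⟨y, hy⟩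
      refine ⟨ι x, ⟨x, x.2, rfl⟩, ?_⟩
      rw [← show (e x : S) = y by rw [hx], hg]
      rfl
    · rintro _ ⟨_, ⟨x, hx, rfl⟩, rfl⟩
      exact ⟨e ⟨x, hx⟩, (e ⟨x, hx⟩).2, hg ⟨x, hx⟩⟩
  · rintro ⟨g, hgM, h⟩
    let e : P ≃* Q := ((P.equivMapOfInjective ι hF.injective).trans
      ((P.map ι).equivMapOfInjective (MulAut.conj g).toMonoidHom (MulAut.conj g).injective)).trans
      ((MulEquiv.subgroupCongr h.symm).trans (Q.equivMapOfInjective ι hF.injective).symm)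
    refine ⟨e, (hF.mem_hom_iff _).2 ⟨g, hgM, fun x => ?_⟩⟩
    have h1 : ∀ z, ι ((Q.equivMapOfInjective ι hF.injective).symm z) = (z : Γ) := fun z => by
      rw [← Subgroup.coe_equivMapOfInjective_apply _ _ hF.injective, MulEquiv.apply_symm_apply]
    exact h1 _

theorem normalizerIn_conj {P Q : Subgroup S} {g : Γ} (hg : g ∈ M)
    (h : Q.map ι = (P.map ι).map (MulAut.conj g).toMonoidHom) :
    normalizerIn ι M Q = (normalizerIn ι M P).map (MulAut.conj g).toMonoidHom := by
  rw [normalizerIn, normalizerIn, Subgroup.map_inf _ _ _ (MulAut.conj g).injective, h]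
  congr 1
  · refine le_antisymm (fun x hx => ⟨g⁻¹ * x * g, M.mul_mem (M.mul_mem (M.inv_mem hg) hx) hg,
      by simp [mul_assoc]⟩) ?_
    · rintro _ ⟨x, hx, rfl⟩
      exact M.mul_mem (M.mul_mem hg hx) (M.inv_mem hg)
  · exact (Subgroup.map_equiv_normalizer_eq _ (MulAut.conj g)).symm

theorem card_normalizerIn_conj {P Q : Subgroup S} {g : Γ} (hg : g ∈ M)
    (h : Q.map ι = (P.map ι).map (MulAut.conj g).toMonoidHom) :
    Nat.card (normalizerIn ι M Q) = Nat.card (normalizerIn ι M P) := by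
  rw [normalizerIn_conj hg h]
  exact Nat.card_congr (Subgroup.equivMapOfInjective _ _ (MulAut.conj g).injective).toEquiv.symm

theorem IsRealizedBy.map_normalizer_le (hF : F.IsRealizedBy ι M) (Q : Subgroup S) :
    (Subgroup.normalizer (Q : Set S)).map ι ≤ normalizerIn ι M Q := by
  rintro _ ⟨s, hs, rfl⟩
  exact ⟨hF.mem s, (mem_normalizer_map_iff hF.injective Q s).2 hs⟩

theorem IsRealizedBy.hasSylowNormalizer_of_card {p : ℕ} [Fact p.Prime] (hS : IsPGroup p S)
    (hF : F.IsRealizedBy ι M) {Q : Subgroup S} (hfin : Finite (normalizerIn ι M Q))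
    (hc : p ^ (Nat.card (normalizerIn ι M Q)).factorization p ≤
      Nat.card (Subgroup.normalizer (Q : Set S))) : HasSylowNormalizer p ι M Q := by
  have hle := hF.map_normalizer_le Q
  refine ⟨hfin, hle, ?_⟩
  have hT : IsPGroup p ((Subgroup.normalizer (Q : Set S)).map ι) := (hS.to_subgroup _).map ι
  obtain ⟨P, hP⟩ := (hT.comap_subtype (K := normalizerIn ι M Q)).exists_le_sylow
  refine ⟨P, (Subgroup.eq_of_le_of_card_ge hP ?_).symm⟩
  refine P.card_eq_multiplicity.le.trans (hc.trans_eq ?_)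
  exact Nat.card_congr (((Subgroup.normalizer (Q : Set S)).equivMapOfInjective ι
    hF.injective).trans (Subgroup.subgroupOfEquivOfLe hle).symm).toEquiv

theorem HasSylowNormalizer.card_eq {p : ℕ} [Fact p.Prime] {Q : Subgroup S}
    (h : HasSylowNormalizer p ι M Q) (hι : Function.Injective ι) :
    Nat.card (Subgroup.normalizer (Q : Set S)) =
      p ^ (Nat.card (normalizerIn ι M Q)).factorization p := by
  obtain ⟨hfin, hle, P, hP⟩ := h
  rw [← P.card_eq_multiplicity, hP]
  exact Nat.card_congr (((Subgroup.normalizer (Q : Set S)).equivMapOfInjective ι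
    hι).trans (Subgroup.subgroupOfEquivOfLe hle).symm).toEquiv

theorem IsRealizedBy.exists_hasSylowNormalizer {p : ℕ} [Fact p.Prime] (hS : IsPGroup p S)
    [Finite S] (hF : F.IsRealizedBy ι M) {Q : Subgroup S} (hfin : Finite (normalizerIn ι M Q))
    (h : ∀ T ≤ normalizerIn ι M Q, IsPGroup p T → ∃ g ∈ M, ∀ t ∈ T, g * t * g⁻¹ ∈ ι.range) :
    ∃ Q', F.IsConj Q Q' ∧ HasSylowNormalizer p ι M Q' := by
  have hQ : IsPGroup p (Q.map ι) := (hS.to_subgroup _).map ι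
  have hQN : Q.map ι ≤ normalizerIn ι M Q :=
    (Subgroup.map_mono Subgroup.le_normalizer).trans (hF.map_normalizer_le Q)
  obtain ⟨P, hP⟩ := (hQ.comap_subtype (K := normalizerIn ι M Q)).exists_le_sylow
  let T : Subgroup Γ := (P : Subgroup (normalizerIn ι M Q)).map (Subgroup.subtype _)
  have hTN : T ≤ normalizerIn ι M Q := Subgroup.map_subtype_le _
  have hQT : Q.map ι ≤ T := fun x hx => ⟨⟨x, hQN hx⟩, hP hx, rfl⟩
  obtain ⟨g, hgM, hg⟩ := h T hTN (P.2.map _)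
  have hmap : ∀ V ≤ T, ((V.map (MulAut.conj g).toMonoidHom).comap ι).map ι =
      V.map (MulAut.conj g).toMonoidHom := by
    intro V hV
    rw [Subgroup.map_comap_eq, inf_eq_right]
    rintro _ ⟨t, ht, rfl⟩
    exact hg t (hV ht)
  let Q' := ((Q.map ι).map (MulAut.conj g).toMonoidHom).comap ι
  have hQ' : Q'.map ι = (Q.map ι).map (MulAut.conj g).toMonoidHom := hmap _ hQT
  have hcard := card_normalizerIn_conj hgM hQ'
  refine ⟨Q', hF.isConj_iff.2 ⟨g, hgM, hQ'⟩, hF.hasSylowNormalizer_of_card hS ?_ ?_⟩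
  · rw [normalizerIn_conj hgM hQ']
    exact Finite.of_equiv _
      (Subgroup.equivMapOfInjective _ _ (MulAut.conj g).injective).toEquiv
  · rw [hcard, ← P.card_eq_multiplicity]
    have h1 : (T.map (MulAut.conj g).toMonoidHom).comap ι ≤
        Subgroup.normalizer (Q' : Set S) := by
      intro s hs
      rw [← mem_normalizer_map_iff hF.injective]
      have hs' : ι s ∈ (normalizerIn ι M Q).map (MulAut.conj g).toMonoidHom :=
        Subgroup.map_mono hTN hs
      rw [← normalizerIn_conj hgM hQ'] at hs'
      exact hs'.2
    have h2 : Nat.card ((T.map (MulAut.conj g).toMonoidHom).comap ι) = Nat.card P := by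
      rw [Nat.card_congr (Subgroup.equivMapOfInjective
        ((T.map (MulAut.conj g).toMonoidHom).comap ι) ι hF.injective).toEquiv, hmap T le_rfl]
      exact (Nat.card_congr ((Subgroup.equivMapOfInjective _ _ (Subgroup.subtype_injective _)).trans
        (Subgroup.equivMapOfInjective T _ (MulAut.conj g).injective)).toEquiv).symm
    rw [← h2]
    exact Nat.card_le_card_of_injective _ (Subgroup.inclusion_injective h1)

theorem isFullyAutomized_bot (F : FusionSystem S) (p : ℕ) [Fact p.Prime] :
    F.IsFullyAutomized p ⊥ := by
  have : Subsingleton (MulAut (⊥ : Subgroup S)) :=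
    ⟨fun a b => MulEquiv.ext fun x => Subsingleton.elim _ _⟩
  exact ⟨default, Subsingleton.elim _ _⟩

theorem isReceptive_bot (F : FusionSystem S) : F.IsReceptive ⊥ := by
  intro Q e _
  refine ⟨Subgroup.inclusion le_top, F.conj_mem _ 1 (fun x => by simp), fun x y hxy => ?_⟩
  have hx : x = 1 := e.injective (Subsingleton.elim _ _)
  subst hx
  simpa using hxy

theorem IsRealizedBy.isSaturated {p : ℕ} [Fact p.Prime] (hS : IsPGroup p S)
    (hF : F.IsRealizedBy ι M)
    (h : ∀ Q : Subgroup S, Q ≠ ⊥ → ∃ Q', F.IsConj Q Q' ∧ HasSylowNormalizer p ι M Q') :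
    F.IsSaturated p := by
  intro Q
  by_cases hQ : Q = ⊥
  · subst hQ
    exact ⟨⊥, hF.isConj_iff.2 ⟨1, M.one_mem, by simp⟩, F.isFullyAutomized_bot p, F.isReceptive_bot⟩
  · obtain ⟨Q', hQ', h'⟩ := h Q hQ
    exact ⟨Q', hQ', hF.isFullyAutomized h', hF.isReceptive hS h'⟩

/-- The normalizer system `N_F(Q)` is realized by `N_M(Q)`. -/
theorem IsRealizedBy.normalizer (hF : F.IsRealizedBy ι M) (Q : Subgroup S) :
    (F.normalizer Q).IsRealizedBy (ι.comp (Subgroup.normalizer (Q : Set S)).subtype)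
      (normalizerIn ι M Q) := by
  refine ⟨hF.injective.comp (Subgroup.subtype_injective _),
    fun s => hF.map_normalizer_le Q ⟨s, s.2, rfl⟩, fun {P R} f => ⟨?_, ?_⟩⟩
  · rintro ⟨g, hg, hgQ, hgf⟩
    obtain ⟨m, hmM, hm⟩ := (hF.mem_hom_iff _).1 hg
    refine ⟨m, ⟨hmM, ?_⟩, fun x => ?_⟩
    · have hQ : ∀ z ∈ Q, z ∈ P.map (Subgroup.subtype (Subgroup.normalizer (Q : Set S))) ⊔ Q :=
        fun z hz => Subgroup.mem_sup_right hz
      refine Subgroup.mem_normalizer_iff.2 fun y => ⟨?_, ?_⟩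
      · rintro ⟨z, hz, rfl⟩
        exact ⟨_, (hgQ _).2 ⟨⟨z, hQ z hz⟩, hz, rfl⟩, hm _⟩
      · rintro ⟨z, hz, hzy⟩
        obtain ⟨w, hw, rfl⟩ := (hgQ z).1 hz
        rw [hm] at hzy
        exact ⟨w, hw, mul_left_cancel (mul_right_cancel hzy)⟩
    · have h := hm ⟨x, Subgroup.mem_sup_left ⟨x, x.2, rfl⟩⟩
      rw [hgf x _ rfl] at h
      exact h
  · rintro ⟨m, ⟨hmM, hm⟩, hmf⟩
    have hle : (P.map (Subgroup.subtype (Subgroup.normalizer (Q : Set S))) ⊔ Q).map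
        ((MulAut.conj m).toMonoidHom.comp ι) ≤
        (R.map (Subgroup.subtype (Subgroup.normalizer (Q : Set S))) ⊔ Q).map ι := by
      rw [Subgroup.map_sup, Subgroup.map_sup]
      refine sup_le_sup ?_ ?_
      · rintro _ ⟨_, ⟨x, hx, rfl⟩, rfl⟩
        exact ⟨f ⟨x, hx⟩, ⟨_, (f ⟨x, hx⟩).2, rfl⟩, hmf ⟨x, hx⟩⟩
      · rintro _ ⟨x, hx, rfl⟩
        exact (Subgroup.mem_normalizer_iff.1 hm _).1 ⟨x, hx, rfl⟩
    obtain ⟨g, hg⟩ := exists_hom_of_conj hF.injective m fun x hx => hle ⟨x, hx, rfl⟩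
    refine ⟨g, (hF.mem_hom_iff _).2 ⟨m, hmM, hg⟩, fun z => ⟨fun hz => ?_, ?_⟩, fun x y hxy => ?_⟩
    · have h1 : m⁻¹ * ι z * m ∈ Q.map ι := by
        refine (Subgroup.mem_normalizer_iff.1 hm _).2 ?_
        simpa [mul_assoc] using ⟨z, hz, rfl⟩
      obtain ⟨w, hw, hwz⟩ := h1
      refine ⟨⟨w, Subgroup.mem_sup_right hw⟩, hw, hF.injective ?_⟩
      rw [hg, hwz]
      group
    · rintro ⟨y, hy, rfl⟩
      rw [← Subgroup.mem_map_iff_mem hF.injective, hg]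
      exact (Subgroup.mem_normalizer_iff.1 hm _).1 ⟨y, hy, rfl⟩
    · refine hF.injective ?_
      rw [hg, hxy]
      exact (hmf x).symm

/-- A finite group `M` with Sylow `p`-subgroup `S` and with a normal `p`-subgroup `X` such that all
elements of `p`-power order which centralize `X` lie in `X` has a constrained fusion system. -/
theorem IsRealizedBy.isConstrained {p : ℕ} [Fact p.Prime] (hS : IsPGroup p S) [Finite S]
    (hF : F.IsRealizedBy ι M) (hfin : Finite M) (hsyl : IsSylowIn p ι.range M) {X : Subgroup Γ}
    (hXM : X ≤ M) (hX : IsPGroup p X) (hMX : M ≤ Subgroup.normalizer (X : Set Γ))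
    (hcent : ∀ y ∈ M, y ∈ Subgroup.centralizer (X : Set Γ) → (∃ j, y ^ p ^ j = 1) → y ∈ X) :
    F.IsConstrained p := by
  have hXr : X ≤ ι.range := by
    obtain ⟨g, hg, h⟩ := hsyl.exists_conj hfin le_rfl hsyl.1 hX hXM
    intro x hx
    have := h (g⁻¹ * x * g) ((Subgroup.mem_normalizer_iff.1 (hMX hg) _).2 (by
      simpa [mul_assoc] using hx))
    simpa [mul_assoc] using this
  have hmap : (X.comap ι).map ι = X := by
    rw [Subgroup.map_comap_eq, inf_eq_right]
    exact hXr
  have hXconj : ∀ g ∈ M, ∀ x, x ∈ X ↔ g * x * g⁻¹ ∈ X := fun g hg x =>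
    Subgroup.mem_normalizer_iff.1 (hMX hg) x
  refine ⟨hF.isSaturated hS fun Q _ => ?_, X.comap ι, ⟨⟨fun x hx s => ?_⟩, ?_⟩, ?_⟩
  · refine hF.exists_hasSylowNormalizer hS
      (Finite.of_injective _ (Subgroup.inclusion_injective inf_le_left)) fun T hT hTp => ?_
    exact hsyl.exists_conj hfin le_rfl hsyl.1 hTp (hT.trans inf_le_left)
  · rw [Subgroup.mem_comap, map_mul, map_mul, map_inv]
    exact (hXconj _ (hF.mem s) _).1 hx
  · intro P R f hf
    obtain ⟨m, hmM, hm⟩ := (hF.mem_hom_iff _).1 hf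
    have hle : (P ⊔ X.comap ι).map ((MulAut.conj m).toMonoidHom.comp ι) ≤
        (R ⊔ X.comap ι).map ι := by
      rw [Subgroup.map_sup, Subgroup.map_sup, hmap]
      refine sup_le_sup ?_ ?_
      · rintro _ ⟨x, hx, rfl⟩
        exact ⟨f ⟨x, hx⟩, (f ⟨x, hx⟩).2, hm ⟨x, hx⟩⟩
      · rintro _ ⟨x, hx, rfl⟩
        exact (hXconj m hmM _).1 hx
    obtain ⟨g, hg⟩ := exists_hom_of_conj hF.injective m fun x hx => hle ⟨x, hx, rfl⟩
    refine ⟨g, (hF.mem_hom_iff _).2 ⟨m, hmM, hg⟩, fun z => ⟨fun hz => ?_, ?_⟩, fun x y hxy => ?_⟩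
    · have h1 : m⁻¹ * ι z * m ∈ X := (hXconj m hmM _).2 (by simpa [mul_assoc] using hz)
      obtain ⟨w, hw⟩ := hXr h1
      have hwX : w ∈ X.comap ι := by rwa [Subgroup.mem_comap, hw]
      refine ⟨⟨w, Subgroup.mem_sup_right hwX⟩, hwX, hF.injective ?_⟩
      rw [hg, hw]
      group
    · rintro ⟨y, hy, rfl⟩
      rw [Subgroup.mem_comap, hg]
      exact (hXconj m hmM _).1 hy
    · refine hF.injective ?_
      rw [hg, hxy, hm]
  · intro Q hQ
    obtain ⟨m, hmM, hm⟩ := hF.isConj_iff.1 hQ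
    have hQX : Q.map ι = X := by
      rw [hm, hmap]
      refine le_antisymm ?_ fun x hx => ?_
      · rintro _ ⟨x, hx, rfl⟩
        exact (hXconj m hmM x).1 hx
      · exact ⟨m⁻¹ * x * m, (hXconj m hmM _).2 (by simpa [mul_assoc] using hx),
          by simp [mul_assoc]⟩
    intro s hs
    rw [← Subgroup.mem_map_iff_mem hF.injective, hQX]
    refine hcent _ (hF.mem s) ?_ ?_
    · rw [← hQX, Subgroup.mem_centralizer_iff]
      rintro _ ⟨x, hx, rfl⟩
      rw [← map_mul, ← map_mul, Subgroup.mem_centralizer_iff.1 hs x hx]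
    · obtain ⟨j, hj⟩ := hS s
      exact ⟨j, by rw [← map_pow, hj, map_one]⟩

/-- Characteristic `p`-type, read off from the normalizers in `M` of the nontrivial subgroups `Q` of
`S`: these are to be finite, their `p`-subgroups are to be conjugate into `S`, and each has to have
a normal `p`-subgroup containing all `p`-elements which centralize it. -/
theorem IsRealizedBy.isOfCharacteristicPType {p : ℕ} [Fact p.Prime] (hS : IsPGroup p S) [Finite S]
    (hF : F.IsRealizedBy ι M)
    (hfin : ∀ Q : Subgroup S, Q ≠ ⊥ → Finite (normalizerIn ι M Q))
    (hconj : ∀ Q : Subgroup S, Q ≠ ⊥ → ∀ T ≤ normalizerIn ι M Q, IsPGroup p T →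
      ∃ g ∈ M, ∀ t ∈ T, g * t * g⁻¹ ∈ ι.range)
    (hX : ∀ Q : Subgroup S, Q ≠ ⊥ → ∃ X ≤ normalizerIn ι M Q, IsPGroup p X ∧
      normalizerIn ι M Q ≤ Subgroup.normalizer (X : Set Γ) ∧
      ∀ y ∈ normalizerIn ι M Q, y ∈ Subgroup.centralizer (X : Set Γ) →
        (∃ j, y ^ p ^ j = 1) → y ∈ X) :
    F.IsOfCharacteristicPType p := by
  have key := fun Q hQ => hF.exists_hasSylowNormalizer hS (hfin Q hQ) (hconj Q hQ)
  refine ⟨hF.isSaturated hS key, fun Q hQ hfull => ?_⟩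
  obtain ⟨Q', hQQ', hQ'⟩ := key Q hQ
  obtain ⟨g, hgM, hg⟩ := hF.isConj_iff.1 hQQ'
  have hsyl : HasSylowNormalizer p ι M Q := by
    refine hF.hasSylowNormalizer_of_card hS (hfin Q hQ) ?_
    rw [← card_normalizerIn_conj hgM hg, ← hQ'.card_eq hF.injective]
    exact hfull Q' hQQ'
  obtain ⟨X, hXN, hXp, hNX, hXc⟩ := hX Q hQ
  refine (hF.normalizer Q).isConstrained (hS.to_subgroup _) (hfin Q hQ) ?_ hXN hXp hNX hXc
  rw [MonoidHom.range_comp, Subgroup.range_subtype]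
  exact hsyl.isSylowIn

end Realization

end FusionSystem

/-! ### Reduced words in an amalgamated product of two groups -/

namespace Monoid.PushoutI

variable {G : Bool → Type u} {K : Type u} [∀ b, Group (G b)] [Group K] {φ : ∀ b, K →* G b}

/-- `AltWord i j x`: the element `x` of the amalgamated product of two groups is the product of a
nonempty reduced word, that is, of factors which lie alternately in one of the two groups but never
in the amalgamated subgroup, where the first factor has index `i` and the last one index `j`. -/
inductive AltWord : Bool → Bool → PushoutI φ → Prop
  | letter (i : Bool) (x : PushoutI φ) (hx : x ∈ (of (φ := φ) i).range)
      (hb : x ∉ (base φ).range) : AltWord i i x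
  | cons (i j : Bool) (x y : PushoutI φ) (hx : x ∈ (of (φ := φ) i).range)
      (hb : x ∉ (base φ).range) (hy : AltWord (!i) j y) : AltWord i j (x * y)

theorem base_range_le (i : Bool) : (base φ).range ≤ (of (φ := φ) i).range := by
  rintro _ ⟨h, rfl⟩
  exact ⟨φ i h, of_apply_eq_base φ i h⟩

namespace AltWord

theorem exists_word {i j : Bool} {x : PushoutI φ} (h : AltWord i j x) :
    ∃ w : CoprodI.Word G, Reduced φ w ∧ w.fstIdx = some i ∧ ofCoprodI w.prod = x := by
  have aux : ∀ (i : Bool) (w : CoprodI.Word G) (g : G i), Reduced φ w → w.fstIdx ≠ some i →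
      of (φ := φ) i g ∉ (base φ).range → ∃ w' : CoprodI.Word G, Reduced φ w' ∧
        w'.fstIdx = some i ∧ ofCoprodI w'.prod = of (φ := φ) i g * ofCoprodI w.prod := by
    intro i w g hw hi hg
    have hg' : g ∉ (φ i).range := by
      rintro ⟨k, rfl⟩
      exact hg ⟨k, (of_apply_eq_base φ i k).symm⟩
    have hg1 : g ≠ 1 := by
      rintro rfl
      exact hg' (one_mem _)
    refine ⟨CoprodI.Word.cons g w hi hg1, ?_, rfl, ?_⟩
    · intro y hy
      rcases List.mem_cons.1 hy with rfl | hy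
      · exact hg'
      · exact hw y hy
    · rw [CoprodI.Word.prod_cons, map_mul, ofCoprodI_of]
  induction h with
  | letter i x hx hb =>
    obtain ⟨g, rfl⟩ := hx
    obtain ⟨w, h1, h2, h3⟩ := aux i CoprodI.Word.empty g (fun _ h => absurd h List.not_mem_nil)
      (by simp [CoprodI.Word.fstIdx, CoprodI.Word.empty]) hb
    exact ⟨w, h1, h2, by simpa using h3⟩
  | cons i j x y hx hb hy ih =>
    obtain ⟨g, rfl⟩ := hx
    obtain ⟨w, h1, h2, rfl⟩ := ih
    exact aux i w g h1 (by simp [h2]) hb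

theorem notMem_base (hφ : ∀ b, Function.Injective (φ b)) {i j : Bool} {x : PushoutI φ}
    (h : AltWord i j x) : x ∉ (base φ).range := by
  obtain ⟨w, hw, hi, rfl⟩ := h.exists_word
  intro hb
  rw [hw.eq_empty_of_mem_range hφ hb] at hi
  simp [CoprodI.Word.fstIdx, CoprodI.Word.empty] at hi

theorem mul {i j l : Bool} {x y : PushoutI φ} (hx : AltWord i j x) (hy : AltWord (!j) l y) :
    AltWord i l (x * y) := by
  induction hx with
  | letter i x hx hb => exact cons i l x y hx hb hy
  | cons i j x z hx hb _ ih =>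
    rw [mul_assoc]
    exact cons i l x _ hx hb (ih hy)

theorem inv {i j : Bool} {x : PushoutI φ} (hx : AltWord i j x) : AltWord j i x⁻¹ := by
  induction hx with
  | letter i x hx hb => exact letter i _ (inv_mem hx) (by simpa using hb)
  | cons i j x z hx hb _ ih =>
    rw [mul_inv_rev]
    refine ih.mul ?_
    rw [Bool.not_not]
    exact letter i _ (inv_mem hx) (by simpa using hb)

theorem base_mul {i j : Bool} {b x : PushoutI φ} (hb : b ∈ (base φ).range)
    (hx : AltWord i j x) : AltWord i j (b * x) := by
  cases hx with
  | letter _ _ hx hx' =>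
    exact letter _ _ (mul_mem (base_range_le _ hb) hx) (by rwa [Subgroup.mul_mem_cancel_left _ hb])
  | cons _ _ x y hx hx' hy =>
    rw [← mul_assoc]
    exact cons _ _ _ _ (mul_mem (base_range_le _ hb) hx)
      (by rwa [Subgroup.mul_mem_cancel_left _ hb]) hy

end AltWord

theorem mem_base_or_altWord (x : PushoutI φ) :
    x ∈ (base φ).range ∨ ∃ i j, AltWord i j x := by
  have hof : ∀ (i : Bool) (g : G i) (y : PushoutI φ),
      (y ∈ (base φ).range ∨ ∃ i' j, AltWord i' j y) →
      (of (φ := φ) i g * y ∈ (base φ).range ∨ ∃ i' j, AltWord i' j (of i g * y)) := by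
    intro i g y hy
    have hg : of (φ := φ) i g ∈ (of (φ := φ) i).range := ⟨g, rfl⟩
    generalize of (φ := φ) i g = x at *
    by_cases hx : x ∈ (base φ).range
    · rcases hy with hy | ⟨i', j, hy⟩
      · exact Or.inl (mul_mem hx hy)
      · exact Or.inr ⟨i', j, hy.base_mul hx⟩
    · rcases hy with hy | ⟨i', j, hy⟩
      · refine Or.inr ⟨i, i, .letter i _ (mul_mem hg (base_range_le i hy)) ?_⟩
        rwa [Subgroup.mul_mem_cancel_right _ hy]
      · by_cases hi : i' = i
        · subst hi
          cases hy with
          | letter _ _ hy hy' =>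
            by_cases hxy : x * y ∈ (base φ).range
            · exact Or.inl hxy
            · exact Or.inr ⟨_, _, .letter _ _ (mul_mem hg hy) hxy⟩
          | cons _ _ y z hy hy' hz =>
            rw [← mul_assoc]
            by_cases hxy : x * y ∈ (base φ).range
            · exact Or.inr ⟨_, _, hz.base_mul hxy⟩
            · exact Or.inr ⟨_, _, .cons _ _ _ _ (mul_mem hg hy) hxy hz⟩
        · have hi' : i' = !i := by cases i <;> cases i' <;> simp_all
          subst hi'
          exact Or.inr ⟨_, _, .cons _ _ _ _ hg hx hy⟩
  suffices h : ∀ y, (y ∈ (base φ).range ∨ ∃ i j, AltWord i j y) →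
      (x * y ∈ (base φ).range ∨ ∃ i j, AltWord i j (x * y)) by
    simpa using h 1 (Or.inl (one_mem _))
  induction x using induction_on with
  | of => exact hof _ _
  | base h =>
    intro y hy
    rw [← of_apply_eq_base φ true h]
    exact hof true _ y hy
  | mul a b iha ihb =>
    intro y hy
    rw [mul_assoc]
    exact iha _ (ihb y hy)

namespace AltWord

/-- Conjugating an element `a` of one factor by a reduced word starting in the other factor moves it
out of both factors, unless `a` lies in the amalgamated subgroup. In terms of the Bass-Serre tree:
if `a` fixes a vertex and the endpoint of a path starting there, then it fixes the first edge. -/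
theorem mem_base_of_conj_mem (hφ : ∀ b, Function.Injective (φ b)) {i j l : Bool}
    {a x : PushoutI φ} (hx : AltWord (!i) j x) (ha : a ∈ (of (φ := φ) i).range)
    (hc : x⁻¹ * a * x ∈ (of (φ := φ) l).range) : a ∈ (base φ).range := by
  by_contra hab
  -- the case where the last letter of `x` does not cancel
  have key : ∀ {j : Bool} {x c : PushoutI φ}, AltWord (!i) j x → x⁻¹ * a * x = c →
      c ∉ (of (φ := φ) (!j)).range := by
    intro j x c hx hc hcl
    have h1 : AltWord j j c := by
      rw [← hc]
      refine AltWord.mul (j := i) ?_ hx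
      refine AltWord.mul hx.inv ?_
      rw [Bool.not_not]
      exact letter i a ha hab
    have hcb := h1.notMem_base hφ
    have h2 := h1.mul (letter (!j) c⁻¹ (inv_mem hcl) (by simpa using hcb))
    rw [mul_inv_cancel] at h2
    exact h2.notMem_base hφ (one_mem _)
  by_cases hl : l = !j
  · subst hl
    exact key hx rfl hc
  · have hl' : l = j := by cases l <;> cases j <;> simp_all
    subst hl'
    have hxi := hx.inv
    generalize hy : x⁻¹ = y at hxi
    have hxy : x = y⁻¹ := by rw [← hy, inv_inv]
    subst hxy
    cases hxi with
    | letter _ _ hy1 hy2 =>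
      have ha' : a ∈ (of (φ := φ) (!i)).range := by
        have h3 := mul_mem (mul_mem (inv_mem hy1) hc) hy1
        simpa [mul_assoc] using h3
      have h4 := (inf_of_range_eq_base_range hφ (i := i) (j := !i) (by simp)).le ⟨ha, ha'⟩
      exact hab h4
    | cons _ _ y z hy1 hy2 hz =>
      refine key (c := z * a * z⁻¹) hz.inv (by simp) ?_
      rw [Bool.not_not]
      have h3 := mul_mem (mul_mem (inv_mem hy1) hc) hy1
      simpa [mul_assoc] using h3

end AltWord

end Monoid.PushoutI

/-! ### Binary forms and elements of `p`-power order of linear groups -/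

namespace ClellandParker

open Matrix MvPolynomial

section Polynomials

variable {k : Type u} [Field k]

/-- The dehomogenization `f(x₀, x₁) ↦ f(1, T)`. -/
noncomputable def dehomogenize : MvPolynomial (Fin 2) k →ₐ[k] Polynomial k :=
  aeval ![1, Polynomial.X]

theorem dehomogenize_monomial (d : Fin 2 →₀ ℕ) (c : k) :
    dehomogenize (monomial d c) = Polynomial.monomial (d 1) c := by
  rw [dehomogenize, aeval_monomial, Finsupp.prod_fintype _ _ (fun _ => pow_zero _)]
  simp [Fin.prod_univ_two, Polynomial.C_mul_X_pow_eq_monomial]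

theorem eq_of_degree_eq {d e : Fin 2 →₀ ℕ} {n : ℕ} (hd : d.degree = n) (he : e.degree = n)
    (h : d 1 = e 1) : d = e := by
  rw [Finsupp.degree_eq_sum, Fin.sum_univ_two] at hd he
  ext i
  fin_cases i
  · simp only [Fin.zero_eta]
    omega
  · exact h

theorem coeff_dehomogenize {n : ℕ} {f : MvPolynomial (Fin 2) k} (hf : f.IsHomogeneous n)
    {d : Fin 2 →₀ ℕ} (hd : d.degree = n) : (dehomogenize f).coeff (d 1) = f.coeff d := by
  conv_lhs => rw [f.as_sum, map_sum, Polynomial.finsetSum_coeff]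
  simp only [dehomogenize_monomial, Polynomial.coeff_monomial]
  rw [Finset.sum_eq_single d]
  · simp
  · intro e he hed
    refine if_neg fun h => hed (eq_of_degree_eq ?_ hd h)
    by_contra h'
    exact (mem_support_iff.1 he) (hf.coeff_eq_zero h')
  · intro h
    simpa using h

theorem dehomogenize_injective {n : ℕ} {f g : MvPolynomial (Fin 2) k} (hf : f.IsHomogeneous n)
    (hg : g.IsHomogeneous n) (h : dehomogenize f = dehomogenize g) : f = g := by
  ext d
  by_cases hd : d.degree = n
  · rw [← coeff_dehomogenize hf hd, ← coeff_dehomogenize hg hd, h]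
  · rw [hf.coeff_eq_zero hd, hg.coeff_eq_zero hd]

theorem natDegree_dehomogenize_le {n : ℕ} {f : MvPolynomial (Fin 2) k} (hf : f.IsHomogeneous n) :
    (dehomogenize f).natDegree ≤ n := by
  rw [f.as_sum, map_sum]
  refine Polynomial.natDegree_sum_le_of_forall_le _ _ fun d hd => ?_
  rw [dehomogenize_monomial]
  refine (Polynomial.natDegree_monomial_le _).trans ?_
  have hd' : d.degree = n := by
    by_contra h'
    exact (mem_support_iff.1 hd) (hf.coeff_eq_zero h')
  rw [Finsupp.degree_eq_sum, Fin.sum_univ_two] at hd'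
  omega

/-- Upper unitriangular substitutions become translations. -/
theorem dehomogenize_subst {M : Matrix (Fin 2) (Fin 2) k} (h0 : M 0 0 = 1) (h1 : M 1 0 = 0)
    (h2 : M 1 1 = 1) (f : MvPolynomial (Fin 2) k) :
    dehomogenize (subst M f) =
      (dehomogenize f).comp (Polynomial.X + Polynomial.C (M 0 1)) := by
  have h : dehomogenize.comp (subst M) =
      (Polynomial.aeval (Polynomial.X + Polynomial.C (M 0 1))).comp dehomogenize := by
    ext i : 1
    fin_cases i
    · simp [dehomogenize, subst, Fin.sum_univ_two, h0, h1]
    · simp [dehomogenize, subst, Fin.sum_univ_two, h2, add_comm]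
  exact DFunLike.congr_fun h f

/-- A polynomial over a field of characteristic `p` of degree less than `p` which is invariant under
a nontrivial translation is constant: it takes the same value at `p` points. -/
theorem eq_C_of_comp_X_add_C {p : ℕ} [Fact p.Prime] [CharP k p] {f : Polynomial k}
    (hf : f.natDegree < p) {c : k} (hc : c ≠ 0)
    (h : f.comp (Polynomial.X + Polynomial.C c) = f) : f = Polynomial.C (f.eval 0) := by
  have hev : ∀ m : ℕ, f.eval (m * c) = f.eval 0 := by
    intro m
    induction m with
    | zero => simp
    | succ m ih =>
      rw [← ih]
      conv_rhs => rw [← h]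
      simp [add_mul]
  classical
  rw [← sub_eq_zero]
  refine Polynomial.eq_zero_of_natDegree_lt_card_of_eval_eq_zero' _
    ((Finset.range p).image fun m : ℕ => (m : k) * c) ?_ ?_
  · intro x hx
    obtain ⟨m, -, rfl⟩ := Finset.mem_image.1 hx
    simp [hev]
  · rw [Finset.card_image_of_injOn, Finset.card_range]
    · exact lt_of_le_of_lt (Polynomial.natDegree_sub_C).le hf
    · intro a ha b hb hab
      have ha' : a < p := by simpa using ha
      have hb' : b < p := by simpa using hb
      have h1 : (a : k) = b := mul_right_cancel₀ hc hab
      exact Nat.ModEq.eq_of_lt_of_lt ((CharP.natCast_eq_natCast k p).1 h1) ha' hb'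

theorem isHomogeneous_C_mul_X_zero_pow (n : ℕ) (a : k) :
    (C a * X 0 ^ n : MvPolynomial (Fin 2) k).IsHomogeneous n := by
  simpa using (isHomogeneous_X_pow (R := k) (0 : Fin 2) n).C_mul a

theorem isHomogeneous_C_mul_X_zero_pow_mul_X_one {n : ℕ} (hn : 1 ≤ n) (b : k) :
    (C b * (X 0 ^ (n - 1) * X 1) : MvPolynomial (Fin 2) k).IsHomogeneous n := by
  have h := ((isHomogeneous_X_pow (R := k) (0 : Fin 2) (n - 1)).mul (isHomogeneous_X k 1)).C_mul b
  rwa [Nat.sub_add_cancel hn] at h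

variable {p : ℕ} [Fact p.Prime] [CharP k p] {n : ℕ}

/-- For `n < p`, only the multiples of `x₀ⁿ` are fixed by a nontrivial element of `U`. -/
theorem eq_of_subst_eq (hnp : n < p) {M : Matrix (Fin 2) (Fin 2) k} (h0 : M 0 0 = 1)
    (h1 : M 1 0 = 0) (h2 : M 1 1 = 1) (hc : M 0 1 ≠ 0) {f : MvPolynomial (Fin 2) k}
    (hf : f.IsHomogeneous n) (h : subst M f = f) : ∃ a, f = C a * X 0 ^ n := by
  have h3 := eq_C_of_comp_X_add_C (p := p)
    (lt_of_le_of_lt (natDegree_dehomogenize_le hf) hnp) hc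
    (by rw [← dehomogenize_subst h0 h1 h2, h])
  refine ⟨(dehomogenize f).eval 0,
    dehomogenize_injective hf (isHomogeneous_C_mul_X_zero_pow n _) (h3.trans ?_)⟩
  simp [dehomogenize, Polynomial.algebraMap_eq]

theorem eq_of_subst_sub_eq (hn : 1 ≤ n) (hnp : n < p) {M : Matrix (Fin 2) (Fin 2) k}
    (h0 : M 0 0 = 1) (h1 : M 1 0 = 0) (h2 : M 1 1 = 1) (hc : M 0 1 ≠ 0)
    {f : MvPolynomial (Fin 2) k} (hf : f.IsHomogeneous n) {e : k}
    (h : subst M f - f = C e * X 0 ^ n) :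
    ∃ a b, f = C a * X 0 ^ n + C b * (X 0 ^ (n - 1) * X 1) := by
  -- subtracting a suitable multiple of `x₀ⁿ⁻¹ x₁` makes `f` invariant
  have h3 : subst M (f - C (e / M 0 1) * (X 0 ^ (n - 1) * X 1)) =
      f - C (e / M 0 1) * (X 0 ^ (n - 1) * X 1) := by
    have hX : (X 0 : MvPolynomial (Fin 2) k) ^ n = X 0 ^ (n - 1) * X 0 := by
      rw [← pow_succ, Nat.sub_add_cancel hn]
    have hC : (C (e / M 0 1) * C (M 0 1) : MvPolynomial (Fin 2) k) = C e := by
      rw [← C_mul, div_mul_cancel₀ _ hc]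
    rw [map_sub, sub_eq_iff_eq_add.1 h, hX, ← hC]
    simp only [subst, map_mul, map_pow, aeval_X, algHom_C, algebraMap_eq, Fin.sum_univ_two, h0, h1,
      h2, C_1, C_0, one_mul, zero_mul, add_zero]
    ring
  obtain ⟨a, ha⟩ := eq_of_subst_eq hnp h0 h1 h2 hc
    (hf.sub (isHomogeneous_C_mul_X_zero_pow_mul_X_one hn _)) h3
  exact ⟨a, _, sub_eq_iff_eq_add.1 ha⟩

end Polynomials

section PElements

variable {k : Type u} [Field k] {p : ℕ} [Fact p.Prime] [CharP k p]

theorem eq_one_of_pow_eq_one {x : k} {j : ℕ} (h : x ^ p ^ j = 1) : x = 1 := by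
  have h1 : (x - 1) ^ p ^ j = 0 := by rw [sub_pow_char_pow, h, one_pow, sub_self]
  exact sub_eq_zero.1 ((pow_eq_zero_iff (pow_pos (Fact.out : p.Prime).pos j).ne').1 h1)

/-- A matrix of `p`-power order in characteristic `p` is unipotent, so that its trace is its
size. -/
theorem trace_eq_of_pow_eq_one {m : ℕ} [NeZero m] {A : Matrix (Fin m) (Fin m) k} {j : ℕ}
    (h : A ^ p ^ j = 1) : A.trace = m := by
  have h1 : IsNilpotent (A - 1) :=
    ⟨p ^ j, by rw [sub_pow_char_pow_of_commute p j (Commute.one_right A), h, one_pow, sub_self]⟩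
  have h2 := (isNilpotent_trace_of_isNilpotent h1).eq_zero
  rw [trace_sub, trace_one, Fintype.card_fin] at h2
  exact sub_eq_zero.1 h2

/-- In characteristic `p`, transvections have order dividing `p`. -/
theorem pow_char_eq_one_of_sq_eq_zero {m : ℕ} [NeZero m] {A : Matrix (Fin m) (Fin m) k}
    (h : (A - 1) * (A - 1) = 0) : A ^ p ^ 1 = 1 := by
  have h1 : (A - 1) ^ p ^ 1 = 0 := by
    rw [pow_one, ← Nat.sub_add_cancel (Fact.out : p.Prime).two_le, pow_add, pow_two, h, mul_zero]
  rwa [sub_pow_char_pow_of_commute p 1 (Commute.one_right A), one_pow, sub_eq_zero] at h1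

end PElements

end ClellandParker

/-! ### The factor `G` -/

namespace ClellandParker

open Matrix MvPolynomial

section FactorG

variable {k : Type u} [Field k] {n : ℕ}

theorem finite_G [Finite k] : Finite (G k n) := by
  have h1 : Module.Finite k (A k n) :=
    Module.Finite.iff_fg.2 (homogeneousSubmodule_fg (Fin 2) k n)
  have h2 : Finite (A k n) := Module.finite_of_finite k
  have h3 : Finite (Multiplicative (A k n)) := h2
  exact Finite.of_equiv _ SemidirectProduct.equivProd.symm

/-- The homogeneous polynomial which is the component in `A` of an element of `G = DA`. -/
noncomputable def polyPart (g : G k n) : MvPolynomial (Fin 2) k := (g.left.toAdd : A k n)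

theorem isHomogeneous_polyPart (g : G k n) : (polyPart g).IsHomogeneous n :=
  (mem_homogeneousSubmodule n _).1 g.left.toAdd.2

@[ext]
theorem ext_polyPart {g h : G k n} (h1 : polyPart g = polyPart h) (h2 : g.right = h.right) :
    g = h :=
  SemidirectProduct.ext (Multiplicative.toAdd.injective (Subtype.ext h1)) h2

theorem polyPart_mul (g h : G k n) : polyPart (g * h) =
    polyPart g + (g.right.1 : k) • subst (g.right.2 : Matrix _ _ k) (polyPart h) := rfl

theorem polyPart_inr (d : D k) : polyPart (SemidirectProduct.inr d : G k n) = 0 := rfl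

theorem polyPart_one : polyPart (1 : G k n) = 0 := rfl

/-- The element of `A`, as a subgroup of `G = DA`, given by a homogeneous polynomial. -/
noncomputable def ofPoly (f : MvPolynomial (Fin 2) k) (hf : f.IsHomogeneous n) : G k n :=
  SemidirectProduct.inl (Multiplicative.ofAdd ⟨f, (mem_homogeneousSubmodule n f).2 hf⟩)

theorem polyPart_ofPoly (f : MvPolynomial (Fin 2) k) (hf : f.IsHomogeneous n) :
    polyPart (ofPoly f hf) = f := rfl

theorem right_ofPoly (f : MvPolynomial (Fin 2) k) (hf : f.IsHomogeneous n) :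
    (ofPoly f hf).right = 1 := rfl

theorem mem_U_iff (d : D k) : d ∈ U k ↔ d.1 = 1 ∧ d.2 0 0 = 1 ∧ d.2 1 0 = 0 ∧ d.2 1 1 = 1 :=
  Iff.rfl

theorem mem_S_iff (g : G k n) : g ∈ S k n ↔ g.right ∈ U k := Iff.rfl

theorem right_mem_U {g : G k n} (hg : g ∈ S k n) : g.right ∈ U k := hg

/-- The element of `U` with upper right entry `c`. -/
def transvectionU (c : k) : D k :=
  (1, ⟨!![1, c; 0, 1], !![1, -c; 0, 1], by simp [Matrix.one_fin_two], by simp [Matrix.one_fin_two]⟩)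

theorem transvectionU_mem (c : k) : transvectionU c ∈ U k := by
  simp [mem_U_iff, transvectionU]

theorem transvectionU_apply (c : k) : ((transvectionU c).2 : Matrix (Fin 2) (Fin 2) k) =
    !![1, c; 0, 1] := rfl

theorem coe_mul_apply (a b : GL (Fin 2) k) (i j : Fin 2) :
    (a * b) i j = a i 0 * b 0 j + a i 1 * b 1 j := by
  rw [Units.val_mul, Matrix.mul_apply, Fin.sum_univ_two]

theorem U_ext {d : D k} (hd : d ∈ U k) (h : d.2 0 1 = 0) : d = 1 := by
  obtain ⟨h1, h2, h3, h4⟩ := hd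
  refine Prod.ext h1 (Units.ext ?_)
  ext i j
  fin_cases i <;> fin_cases j <;> simp [h2, h3, h4, h]

/-- If an element of `D` conjugates a nontrivial element of `U` into `U`, then it is upper
triangular. -/
theorem lower_eq_zero_of_mul_eq {d u v : D k} (hu : u ∈ U k) (hv : v ∈ U k) (hu1 : u ≠ 1)
    (h : u * d = d * v) : d.2 1 0 = 0 := by
  have hc : u.2 0 1 ≠ 0 := fun h0 => hu1 (U_ext hu h0)
  have h1 := congrArg (fun x : D k => x.2 0 0) h
  simp only [Prod.snd_mul, coe_mul_apply] at h1
  rw [hu.2.1, hv.2.1, hv.2.2.1] at h1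
  simpa [hc] using h1

theorem conj_mem_U {d u : D k} (hd : d.2 1 0 = 0) (hu : u ∈ U k) : d * u * d⁻¹ ∈ U k := by
  obtain ⟨h1, h2, h3, h4⟩ := hu
  have hdet : d.2 0 0 * d.2 1 1 ≠ 0 := by
    have := (Matrix.isUnit_iff_isUnit_det _).1 d.2.isUnit
    rw [Matrix.det_fin_two, hd, mul_zero, sub_zero] at this
    exact this.ne_zero
  have h00 := left_ne_zero_of_mul hdet
  have h11 := right_ne_zero_of_mul hdet
  refine ⟨by simp [h1], ?_⟩
  simp [Matrix.mul_apply, Fin.sum_univ_two, h2, h3, h4, hd, Matrix.inv_def, Matrix.det_fin_two,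
    Matrix.adjugate_fin_two, h00, h11]
  field_simp

theorem subst_X_zero_pow {M : Matrix (Fin 2) (Fin 2) k} (h : M 1 0 = 0) (a : k) :
    subst M (C a * X 0 ^ n) = C (a * M 0 0 ^ n) * X 0 ^ n := by
  simp [subst, Fin.sum_univ_two, h, algebraMap_eq]
  ring

theorem subst_X_zero_pow_of_mem_U {d : D k} (hd : d ∈ U k) (a : k) :
    subst (d.2 : Matrix _ _ k) (C a * X 0 ^ n) = C a * X 0 ^ n := by
  rw [subst_X_zero_pow hd.2.2.1, hd.2.1, one_pow, mul_one]

theorem right_pow (g : G k n) (m : ℕ) : (g ^ m).right = g.right ^ m :=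
  map_pow SemidirectProduct.rightHom g m

theorem polyPart_pow {g : G k n} (hg : g.right = 1) (m : ℕ) :
    polyPart (g ^ m) = m • polyPart g := by
  induction m with
  | zero => simp [polyPart_one]
  | succ m ih =>
    rw [pow_succ, polyPart_mul, ih, right_pow, hg, one_pow, succ_nsmul]
    simp [subst_one]

theorem pow_char_eq_one_of_right_eq_one {p : ℕ} [CharP k p] {g : G k n}
    (hg : g.right = 1) : g ^ p ^ 1 = 1 := by
  refine ext_polyPart ?_ (by rw [right_pow, hg, one_pow]; rfl)
  rw [polyPart_pow hg, pow_one, polyPart_one, ← Nat.cast_smul_eq_nsmul k, CharP.cast_eq_zero,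
    zero_smul]

section

variable {p : ℕ} [Fact p.Prime] [CharP k p]

/-- An element of `p`-power order of `D` with upper triangular matrix lies in `U`: its eigenvalues
are one. -/
theorem mem_U_of_pow_eq_one {d : D k} (hd : d.2 1 0 = 0) {j : ℕ} (h : d ^ p ^ j = 1) :
    d ∈ U k := by
  have h1 : d.1 ^ p ^ j = 1 := congrArg Prod.fst h
  have h2 : d.2 ^ p ^ j = 1 := congrArg Prod.snd h
  have h2' : (d.2 : Matrix (Fin 2) (Fin 2) k) ^ p ^ j = 1 := by
    rw [← Units.val_pow_eq_pow_val, h2, Units.val_one]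
  have h3 : ∀ m : ℕ, ((d.2 : Matrix (Fin 2) (Fin 2) k) ^ m) 1 0 = 0 ∧
      ((d.2 : Matrix (Fin 2) (Fin 2) k) ^ m) 0 0 = d.2 0 0 ^ m := by
    intro m
    induction m with
    | zero => simp
    | succ m ih => simp [pow_succ, Matrix.mul_apply, Fin.sum_univ_two, ih.1, ih.2, hd]
  have h00 : d.2 0 0 = 1 := by
    refine eq_one_of_pow_eq_one (p := p) (j := j) ?_
    rw [← (h3 _).2, h2', one_apply_eq]
  have htr := trace_eq_of_pow_eq_one h2'
  rw [trace_fin_two, h00] at htr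
  refine ⟨Units.ext (eq_one_of_pow_eq_one (p := p) (j := j) ?_), h00, hd, ?_⟩
  · rw [← Units.val_pow_eq_pow_val, h1, Units.val_one]
  · push_cast at htr
    linear_combination htr

theorem mem_S_of_pow_eq_one {g : G k n} (hg : g.right.2 1 0 = 0) {j : ℕ} (h : g ^ p ^ j = 1) :
    g ∈ S k n :=
  mem_U_of_pow_eq_one (d := g.right) hg (j := j) (by rw [← right_pow, h]; rfl)

theorem transvectionU_pow (c : k) : transvectionU c ^ p ^ 1 = 1 := by
  refine Prod.ext (one_pow _) (Units.ext ?_)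
  rw [Prod.pow_snd, Units.val_pow_eq_pow_val]
  refine pow_char_eq_one_of_sq_eq_zero ?_
  rw [transvectionU_apply]
  ext i j
  fin_cases i <;> fin_cases j <;> simp [Matrix.mul_apply, Fin.sum_univ_two]

theorem isPGroup_S : IsPGroup p (S k n) := by
  rintro ⟨g, hg⟩
  refine ⟨2, Subtype.ext ?_⟩
  have h1 : (g ^ p).right = 1 := by
    rw [right_pow]
    have h : g.right = transvectionU (g.right.2 0 1) := by
      obtain ⟨h1, h2, h3, h4⟩ := (mem_S_iff g).1 hg
      refine Prod.ext h1 (Units.ext ?_)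
      rw [transvectionU_apply]
      ext i j
      fin_cases i <;> fin_cases j <;> simp [h2, h3, h4]
    have := transvectionU_pow (p := p) (g.right.2 0 1)
    rwa [← h, pow_one] at this
  have h2 := pow_char_eq_one_of_right_eq_one (p := p) h1
  rw [pow_one, ← pow_mul, ← pow_two] at h2
  exact h2

/-- `S` is a Sylow `p`-subgroup of `G`: a `p`-group containing `U` consists of upper triangular
matrices modulo `A`, as the matrices in it have trace two. -/
theorem eq_S_of_isPGroup {T : Subgroup (G k n)} (hT : IsPGroup p T) (h : S k n ≤ T) :
    T = S k n := by
  refine le_antisymm (fun g hg => ?_) h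
  have htr : ∀ g ∈ T, (g.right.2 : Matrix (Fin 2) (Fin 2) k).trace = (2 : ℕ) := by
    intro g hg
    obtain ⟨j, hj⟩ := hT ⟨g, hg⟩
    have hj' : g ^ p ^ j = 1 := congrArg Subtype.val hj
    refine trace_eq_of_pow_eq_one (p := p) (j := j) ?_
    rw [← Units.val_pow_eq_pow_val, ← Prod.pow_snd, ← right_pow, hj']
    rfl
  have h1 := htr g hg
  have h2 := htr _ (T.mul_mem (h (show SemidirectProduct.inr (transvectionU 1) ∈ S k n from
    transvectionU_mem 1)) hg)
  rw [trace_fin_two] at h1 h2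
  have h3 : g.right.2 1 0 = 0 := by
    rw [SemidirectProduct.mul_right, SemidirectProduct.right_inr, Prod.snd_mul, coe_mul_apply,
      coe_mul_apply, transvectionU_apply] at h2
    simp at h2
    linear_combination h2 - h1
  obtain ⟨j, hj⟩ := hT ⟨g, hg⟩
  exact mem_S_of_pow_eq_one h3 (j := j) (congrArg Subtype.val hj)

/-- `S` as a Sylow `p`-subgroup of `G`. -/
noncomputable def sylowS (p : ℕ) [Fact p.Prime] [CharP k p] : Sylow p (G k n) :=
  { S k n with
    isPGroup' := isPGroup_S
    is_maximal' := fun hT h => eq_S_of_isPGroup hT h }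

theorem transvectionU_ne_one {c : k} (hc : c ≠ 0) : transvectionU c ≠ 1 := by
  intro h
  have := congrArg (fun d : D k => d.2 0 1) h
  simp [transvectionU_apply, hc] at this

theorem inr_transvectionU_mem_S (c : k) :
    (SemidirectProduct.inr (transvectionU c) : G k n) ∈ S k n :=
  transvectionU_mem c

/-- If an element of `G` conjugates an element of `S` outside `A` into `S`, then its matrix is upper
triangular. -/
theorem lower_eq_zero_of_conj_mem_S {g s : G k n} (hs : s ∈ S k n) (hs1 : s.right ≠ 1)
    (h : g⁻¹ * s * g ∈ S k n) : g.right.2 1 0 = 0 :=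
  lower_eq_zero_of_mul_eq (u := s.right) (v := (g⁻¹ * s * g).right) hs h hs1 (by
    simp only [SemidirectProduct.mul_right, SemidirectProduct.inv_right]
    group)

theorem conj_mem_S {g s : G k n} (hg : g.right.2 1 0 = 0) (hs : s ∈ S k n) :
    g * s * g⁻¹ ∈ S k n :=
  conj_mem_U hg hs

theorem mem_Z_iff_of_lt (hn : 1 ≤ n) (hnp : n < p) (g : G k n) :
    g ∈ Z k n ↔ g.right = 1 ∧ ∃ a, polyPart g = C a * X 0 ^ n := by
  constructor
  · rintro ⟨⟨g, hg⟩, hgc, rfl⟩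
    have hcomm : ∀ s ∈ S k n, s * g = g * s := fun s hs =>
      congrArg Subtype.val (Subgroup.mem_center_iff.1 hgc ⟨s, hs⟩)
    change g.right = 1 ∧ ∃ a, polyPart g = C a * X 0 ^ n
    -- commuting with `x₀ⁿ⁻¹ x₁` forces the component in `U` to be trivial
    have h1 : g.right = 1 := by
      have hU := right_mem_U hg
      refine U_ext hU ?_
      have hA : ofPoly _ (isHomogeneous_C_mul_X_zero_pow_mul_X_one hn (1 : k)) ∈ S k n :=
        (U k).one_mem
      have h := congrArg polyPart (hcomm _ hA)
      rw [polyPart_mul, polyPart_mul, right_ofPoly, polyPart_ofPoly, hU.1] at h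
      simp only [Prod.fst_one, Prod.snd_one, Units.val_one, subst_one, one_smul, AlgHom.id_apply]
        at h
      rw [add_comm] at h
      have h' := congrArg (eval ![1, 0]) (add_left_cancel h)
      simpa [subst, Fin.sum_univ_two, hU.2.1, hU.2.2.1] using h'.symm
    refine ⟨h1, ?_⟩
    have h := congrArg polyPart (hcomm _ (inr_transvectionU_mem_S 1))
    rw [polyPart_mul, polyPart_mul, polyPart_inr] at h
    simp only [SemidirectProduct.right_inr, map_zero, smul_zero, add_zero, zero_add] at h
    rw [show (transvectionU (1 : k)).1 = 1 from rfl, Units.val_one, one_smul] at h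
    obtain ⟨h2, h3, h4, h5⟩ := transvectionU_mem (1 : k)
    exact eq_of_subst_eq hnp h3 h4 h5 (by simp [transvectionU_apply]) (isHomogeneous_polyPart g) h
  · rintro ⟨h1, a, ha⟩
    have hg : g ∈ S k n := by
      rw [mem_S_iff, h1]
      exact one_mem _
    refine ⟨⟨g, hg⟩, Subgroup.mem_center_iff.2 fun s => Subtype.ext ?_, rfl⟩
    refine ext_polyPart ?_ ?_
    · change polyPart ((s : G k n) * g) = polyPart (g * (s : G k n))
      rw [polyPart_mul, polyPart_mul, ha, subst_X_zero_pow_of_mem_U (right_mem_U s.2),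
        (right_mem_U s.2).1, h1]
      simp [subst_one, add_comm]
    · change ((s : G k n) * g).right = (g * (s : G k n)).right
      simp [h1]

theorem mem_R_iff_of_lt (hn : 1 ≤ n) (hnp : n < p) (g : G k n) :
    g ∈ R k n ↔ g ∈ S k n ∧ ∃ a, polyPart g = C a * X 0 ^ n := by
  let R' : Subgroup (G k n) :=
    { carrier := {g | g ∈ S k n ∧ ∃ a, polyPart g = C a * X 0 ^ n}
      one_mem' := ⟨one_mem _, 0, by simp [polyPart_one]⟩
      mul_mem' := by
        rintro x y ⟨hx, a, ha⟩ ⟨hy, b, hb⟩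
        refine ⟨mul_mem hx hy, a + b, ?_⟩
        rw [polyPart_mul, ha, hb, subst_X_zero_pow_of_mem_U (right_mem_U hx),
          (right_mem_U hx).1, Units.val_one, one_smul,
          C_add, add_mul]
      inv_mem' := by
        rintro x ⟨hx, a, ha⟩
        refine ⟨inv_mem hx, -a, ?_⟩
        have h := polyPart_mul x⁻¹ x
        rw [inv_mul_cancel, polyPart_one, ha, subst_X_zero_pow_of_mem_U (right_mem_U (inv_mem hx)),
          show (x⁻¹.right.1 : k) = 1 by rw [(right_mem_U (inv_mem hx)).1, Units.val_one],
          one_smul] at h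
        rw [C_neg, neg_mul]
        exact (neg_eq_of_add_eq_zero_left h.symm).symm }
  suffices h : R k n = R' by
    rw [h]
    rfl
  refine le_antisymm (sup_le ?_ ?_) ?_
  · intro z hz
    obtain ⟨h1, h2⟩ := (mem_Z_iff_of_lt hn hnp z).1 hz
    refine ⟨?_, h2⟩
    rw [mem_S_iff, h1]
    exact one_mem _
  · rintro _ ⟨d, hd, rfl⟩
    exact ⟨hd, 0, by simp [polyPart_inr]⟩
  · rintro g ⟨hg, hg'⟩
    rw [← SemidirectProduct.inl_left_mul_inr_right g]
    refine Subgroup.mul_mem_sup ((mem_Z_iff_of_lt hn hnp _).2 ⟨rfl, hg'⟩) ⟨_, hg, rfl⟩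

theorem Z_le_R : Z k n ≤ R k n := le_sup_left

theorem R_le_S (hn : 1 ≤ n) (hnp : n < p) : R k n ≤ S k n := fun g hg =>
  ((mem_R_iff_of_lt hn hnp g).1 hg).1

theorem mem_Z_of_mem_R (hn : 1 ≤ n) (hnp : n < p) {g : G k n} (hg : g ∈ R k n)
    (h : g.right = 1) : g ∈ Z k n :=
  (mem_Z_iff_of_lt hn hnp g).2 ⟨h, ((mem_R_iff_of_lt hn hnp g).1 hg).2⟩

theorem right_eq_one_of_mem_Z (hn : 1 ≤ n) (hnp : n < p) {g : G k n} (hg : g ∈ Z k n) :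
    g.right = 1 :=
  ((mem_Z_iff_of_lt hn hnp g).1 hg).1

theorem lower_eq_zero_of_mem_NR (hn : 1 ≤ n) (hnp : n < p) {g : G k n} (hg : g ∈ NR k n) :
    g.right.2 1 0 = 0 := by
  have hu : (SemidirectProduct.inr (transvectionU 1) : G k n) ∈ R k n :=
    Subgroup.mem_sup_right ⟨_, transvectionU_mem 1, rfl⟩
  have h := (Subgroup.mem_normalizer_iff.1 (inv_mem hg) _).1 hu
  rw [inv_inv] at h
  exact lower_eq_zero_of_conj_mem_S (R_le_S hn hnp hu) (transvectionU_ne_one one_ne_zero)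
    (R_le_S hn hnp h)

theorem polyPart_conj (g s : G k n) : polyPart (g * s * g⁻¹) = polyPart g +
    (g.right.1 : k) • subst (g.right.2 : Matrix _ _ k) (polyPart s) -
    ((g * s * g⁻¹).right.1 : k) • subst ((g * s * g⁻¹).right.2 : Matrix _ _ k) (polyPart g) := by
  have h := polyPart_mul (g * s * g⁻¹) g
  rw [inv_mul_cancel_right, polyPart_mul] at h
  exact eq_sub_of_add_eq h.symm

/-- An element of `G` normalizes `R` if its matrix is upper triangular and its component in `A` lies
in the span of `x₀ⁿ` and `x₀ⁿ⁻¹ x₁`. -/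
theorem mem_NR_of_lower_eq_zero [Finite k] (hn : 1 ≤ n) (hnp : n < p) {g : G k n}
    (hg : g.right.2 1 0 = 0) {a b : k}
    (hab : polyPart g = C a * X 0 ^ n + C b * (X 0 ^ (n - 1) * X 1)) : g ∈ NR k n := by
  have hfin : Finite (G k n) := finite_G
  refine Subgroup.mem_normalizer_fintype fun r hr => ?_
  obtain ⟨hrS, c, hc⟩ := (mem_R_iff_of_lt hn hnp r).1 hr
  have hS := conj_mem_S hg hrS
  refine (mem_R_iff_of_lt hn hnp _).2 ⟨hS, ?_⟩
  rw [polyPart_conj, hc, subst_X_zero_pow hg, hab, map_add,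
    subst_X_zero_pow_of_mem_U (right_mem_U hS)]
  obtain ⟨h1, h2, h3, h4⟩ := right_mem_U hS
  generalize (g * r * g⁻¹).right = d at *
  refine ⟨g.right.1 * (c * g.right.2 0 0 ^ n) - b * d.2 0 1, ?_⟩
  have hX : (X 0 : MvPolynomial (Fin 2) k) ^ n = X 0 ^ (n - 1) * X 0 := by
    rw [← pow_succ, Nat.sub_add_cancel hn]
  rw [h1, Units.val_one, one_smul, smul_eq_C_mul]
  simp only [subst, map_mul, map_pow, aeval_X, algHom_C, algebraMap_eq, Fin.sum_univ_two, h2, h3,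
    h4, C_1, C_0, one_mul, zero_mul, add_zero, hX, C_sub]
  ring

theorem inr_mem_NR [Finite k] (hn : 1 ≤ n) (hnp : n < p) {d : D k} (hd : d.2 1 0 = 0) :
    (SemidirectProduct.inr d : G k n) ∈ NR k n :=
  mem_NR_of_lower_eq_zero hn hnp hd (a := 0) (b := 0) (by simp [polyPart_inr])

/-- An element of `G` conjugating some element of `R \ Z` into `R` normalizes `R`. -/
theorem mem_NR_of_conj_mem_R [Finite k] (hn : 1 ≤ n) (hnp : n < p) {q x : G k n}
    (hq : q ∈ R k n) (hqZ : q ∉ Z k n) (h : x⁻¹ * q * x ∈ R k n) : x ∈ NR k n := by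
  have hq1 : q.right ≠ 1 := fun h1 => hqZ (mem_Z_of_mem_R hn hnp hq h1)
  obtain ⟨hqS, a, ha⟩ := (mem_R_iff_of_lt hn hnp _).1 hq
  obtain ⟨hrS, b, hb⟩ := (mem_R_iff_of_lt hn hnp _).1 h
  have hx := lower_eq_zero_of_conj_mem_S hqS hq1 hrS
  generalize hr : x⁻¹ * q * x = r at *
  have hq' : x * r * x⁻¹ = q := by rw [← hr]; group
  have hp := polyPart_conj x r
  rw [hq', ha, hb, subst_X_zero_pow hx] at hp
  obtain ⟨h1, h2, h3, h4⟩ := (mem_S_iff _).1 hqS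
  rw [h1, Units.val_one, one_smul] at hp
  have hc : q.right.2 0 1 ≠ 0 := fun h0 => hq1 (U_ext hqS h0)
  obtain ⟨a', b', hab⟩ := eq_of_subst_sub_eq hn hnp h2 h3 h4 hc (isHomogeneous_polyPart x)
    (e := x.right.1 * (b * x.right.2 0 0 ^ n) - a) (by
      rw [smul_eq_C_mul] at hp
      simp only [C_sub, C_mul] at hp ⊢
      linear_combination hp)
  exact mem_NR_of_lower_eq_zero hn hnp hx hab

theorem mem_S_of_mem_NR (hn : 1 ≤ n) (hnp : n < p) {g : G k n} (hg : g ∈ NR k n) {j : ℕ}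
    (h : g ^ p ^ j = 1) : g ∈ S k n :=
  mem_S_of_pow_eq_one (lower_eq_zero_of_mem_NR hn hnp hg) h

theorem mem_S_of_commute {y q : G k n} (hq : q ∈ S k n) (hq1 : q.right ≠ 1) (hc : q * y = y * q)
    {j : ℕ} (h : y ^ p ^ j = 1) : y ∈ S k n :=
  mem_S_of_pow_eq_one (lower_eq_zero_of_conj_mem_S hq hq1 (by
    rwa [mul_assoc, hc, inv_mul_cancel_left])) h

/-- Elements of `p`-power order which centralize `A` lie in `A`. -/
theorem right_eq_one_of_commute (hn : 1 ≤ n) {y : G k n}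
    (hc : ∀ a : G k n, a.right = 1 → a * y = y * a) {j : ℕ} (h : y ^ p ^ j = 1) :
    y.right = 1 := by
  have hact : ∀ f : MvPolynomial (Fin 2) k, f.IsHomogeneous n →
      f = (y.right.1 : k) • subst (y.right.2 : Matrix _ _ k) f := by
    intro f hf
    have h1 := congrArg polyPart (hc (ofPoly f hf) rfl)
    rw [polyPart_mul, polyPart_mul, polyPart_ofPoly, right_ofPoly] at h1
    simp only [Prod.fst_one, Prod.snd_one, Units.val_one, subst_one, one_smul, AlgHom.id_apply]
      at h1
    rw [add_comm] at h1
    exact add_left_cancel h1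
  have h10 : y.right.2 1 0 = 0 := by
    have h1 := congrArg (eval ![0, 1]) (hact _ (isHomogeneous_C_mul_X_zero_pow n 1))
    simpa [subst, Fin.sum_univ_two, (Nat.one_le_iff_ne_zero.1 hn)] using h1
  have hU : y.right ∈ U k := mem_S_of_pow_eq_one h10 h
  refine U_ext hU ?_
  have h1 := congrArg (eval ![1, 0]) (hact _ (isHomogeneous_C_mul_X_zero_pow_mul_X_one hn 1))
  simpa [subst, Fin.sum_univ_two, hU.1, hU.2.1, hU.2.2.1] using h1.symm

end

end FactorG

section Residual

variable {p : ℕ} {Γ : Type u} [Group Γ]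

theorem mem_pPrimeResidual {x : Γ} {j : ℕ} (h : x ^ p ^ j = 1) : x ∈ pPrimeResidual p Γ := by
  have hP : IsPGroup p (Subgroup.zpowers x) := by
    rintro ⟨_, m, rfl⟩
    refine ⟨j, Subtype.ext ?_⟩
    change (x ^ m) ^ p ^ j = 1
    rw [← zpow_natCast, zpow_comm, zpow_natCast, h, _root_.one_zpow]
  obtain ⟨Q, hQ⟩ := hP.exists_le_sylow
  exact Subgroup.mem_iSup_of_mem Q (hQ (Subgroup.mem_zpowers x))

theorem pPrimeResidual_le {H : Subgroup Γ} (h : ∀ x : Γ, (∃ j, x ^ p ^ j = 1) → x ∈ H) :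
    pPrimeResidual p Γ ≤ H :=
  iSup_le fun P x hx => h x (by
    obtain ⟨j, hj⟩ := P.2 ⟨x, hx⟩
    exact ⟨j, congrArg Subtype.val hj⟩)

instance normal_pPrimeResidual : (pPrimeResidual p Γ).Normal := by
  refine ⟨fun x hx g => ?_⟩
  have h : pPrimeResidual p Γ ≤ (pPrimeResidual p Γ).comap (MulAut.conj g).toMonoidHom :=
    pPrimeResidual_le fun y ⟨j, hj⟩ => mem_pPrimeResidual (j := j) (by
      rw [← map_pow, hj, map_one])
  exact h hx

end Residual

section FactorG

variable {k : Type u} [Field k] [Finite k] {n : ℕ} {p : ℕ} [Fact p.Prime] [CharP k p]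

theorem pPrimeResidual_sup_NR (hn : 1 ≤ n) (hnp : n < p) :
    pPrimeResidual p (G k n) ⊔ NR k n = ⊤ := by
  have hfin : Finite (G k n) := finite_G
  have hle : S k n ≤ pPrimeResidual p (G k n) := le_iSup (fun P : Sylow p (G k n) =>
    (P : Subgroup (G k n))) (sylowS p)
  have hF := Sylow.normalizer_sup_eq_top' (sylowS p : Sylow p (G k n)) hle
  rw [eq_top_iff, ← hF]
  refine sup_le (fun g hg => ?_) le_sup_left
  have hu := inr_transvectionU_mem_S (n := n) (1 : k)
  have h := (Subgroup.mem_normalizer_iff.1 (inv_mem hg) _).1 hu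
  rw [inv_inv] at h
  have h10 := lower_eq_zero_of_conj_mem_S hu (transvectionU_ne_one one_ne_zero) h
  rw [← SemidirectProduct.inl_left_mul_inr_right g]
  exact Subgroup.mul_mem_sup
    (mem_pPrimeResidual (pow_char_eq_one_of_right_eq_one rfl)) (inr_mem_NR hn hnp h10)

end FactorG

end ClellandParker

/-! ### The factor `H_R` -/

namespace ClellandParker

open Matrix MvPolynomial

section FactorH

variable {k : Type u} [Field k]

theorem mem_H_iff (g : GL (Fin 3) k) : g ∈ H k ↔ g 1 0 = 0 ∧ g 2 0 = 0 := by
  constructor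
  · rintro ⟨c, hc⟩
    rw [mulVec_single_one] at hc
    exact ⟨by simpa using congrFun hc 1, by simpa using congrFun hc 2⟩
  · rintro ⟨h1, h2⟩
    refine ⟨g 0 0, ?_⟩
    rw [mulVec_single_one]
    ext i
    fin_cases i <;> simp [h1, h2]

theorem mem_Borel_iff (g : GL (Fin 3) k) :
    g ∈ Borel k ↔ g 1 0 = 0 ∧ g 2 0 = 0 ∧ g 2 1 = 0 := by
  constructor
  · intro h
    exact ⟨h (i := 1) (j := 0) (by decide), h (i := 2) (j := 0) (by decide),
      h (i := 2) (j := 1) (by decide)⟩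
  · rintro ⟨h1, h2, h3⟩ i j hij
    fin_cases i <;> fin_cases j <;> first | exact absurd hij (by decide) | assumption

theorem mem_unipotentRadical_iff (g : GL (Fin 3) k) : g ∈ unipotentRadical k ↔
    g ∈ Borel k ∧ g 0 0 = 1 ∧ g 1 1 = 1 ∧ g 2 2 = 1 ∧ g 1 2 = 0 := by
  rw [mem_Borel_iff]
  constructor
  · rintro ⟨h0, h⟩
    rw [mulVec_single_one] at h0
    obtain ⟨c, hc⟩ := h (Pi.single 1 1)
    obtain ⟨d, hd⟩ := h (Pi.single 2 1)
    rw [mulVec_single_one] at hc hd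
    refine ⟨⟨?_, ?_, ?_⟩, ?_, ?_, ?_, ?_⟩
    · simpa using congrFun h0 1
    · simpa using congrFun h0 2
    · simpa using congrFun hc 2
    · simpa using congrFun h0 0
    · simpa using congrFun hc 1
    · simpa using congrFun hd 2
    · simpa using congrFun hd 1
  · rintro ⟨⟨h1, h2, h3⟩, h4, h5, h6, h7⟩
    refine ⟨?_, fun v => ⟨g 0 1 * v 1 + g 0 2 * v 2, ?_⟩⟩
    · rw [mulVec_single_one]
      ext i
      fin_cases i <;> simp [h1, h2, h4]
    · ext i
      fin_cases i <;> simp [mulVec, dotProduct, Fin.sum_univ_three, h1, h2, h3, h4, h5, h6, h7]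
      ring

theorem unipotentRadical_le_Borel : unipotentRadical k ≤ Borel k := fun g hg =>
  ((mem_unipotentRadical_iff g).1 hg).1

theorem coe_mul_apply_three (a b : GL (Fin 3) k) (i j : Fin 3) :
    (a * b) i j = a i 0 * b 0 j + a i 1 * b 1 j + a i 2 * b 2 j := by
  rw [Units.val_mul, Matrix.mul_apply, Fin.sum_univ_three]

theorem conj_mem_unipotentRadical {h r : GL (Fin 3) k} (hh : h ∈ H k)
    (hr : r ∈ unipotentRadical k) : h⁻¹ * r * h ∈ unipotentRadical k := by
  have hinv : ∀ v, (↑h⁻¹ : Matrix (Fin 3) (Fin 3) k) *ᵥ ((h : Matrix (Fin 3) (Fin 3) k) *ᵥ v) =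
      v := fun v => by
    rw [mulVec_mulVec, ← Units.val_mul, inv_mul_cancel, Units.val_one, one_mulVec]
  obtain ⟨c, hc⟩ := hh
  obtain ⟨d, hd⟩ := inv_mem (show h ∈ H k from ⟨c, hc⟩)
  obtain ⟨h1, h2⟩ := hr
  refine ⟨?_, fun v => ?_⟩
  · rw [Units.val_mul, Units.val_mul, ← mulVec_mulVec, ← mulVec_mulVec, hc, mulVec_smul, h1, ← hc,
      hinv]
  · obtain ⟨e, he⟩ := h2 ((h : Matrix (Fin 3) (Fin 3) k) *ᵥ v)
    refine ⟨e * d, ?_⟩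
    rw [Units.val_mul, Units.val_mul, ← mulVec_mulVec, ← mulVec_mulVec, he, mulVec_add, hinv,
      mulVec_smul, hd, smul_smul]

/-- The upper unitriangular matrix with entries `a`, `b` and `c` at the positions `(0,1)`, `(0,2)`
and `(1,2)`. -/
def unitriangular (a b c : k) : GL (Fin 3) k :=
  ⟨!![1, a, b; 0, 1, c; 0, 0, 1], !![1, -a, a * c - b; 0, 1, -c; 0, 0, 1],
    by ext i j; fin_cases i <;> fin_cases j <;> simp [Matrix.mul_apply, Fin.sum_univ_three]; ring,
    by ext i j; fin_cases i <;> fin_cases j <;> simp [Matrix.mul_apply, Fin.sum_univ_three]; ring⟩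

theorem unitriangular_apply (a b c : k) :
    (unitriangular a b c : Matrix (Fin 3) (Fin 3) k) = !![1, a, b; 0, 1, c; 0, 0, 1] := rfl

theorem unitriangular_mem_Borel (a b c : k) : unitriangular a b c ∈ Borel k := by
  simp [mem_Borel_iff, unitriangular_apply]

theorem unitriangular_mem_unipotentRadical (a b : k) :
    unitriangular a b 0 ∈ unipotentRadical k :=
  (mem_unipotentRadical_iff _).2 ⟨unitriangular_mem_Borel a b 0, by simp [unitriangular_apply]⟩

variable {p : ℕ} [Fact p.Prime] [CharP k p]

theorem diag_eq_one_of_pow_eq_one {t : GL (Fin 3) k} (ht : t ∈ Borel k) {j : ℕ}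
    (h : t ^ p ^ j = 1) (i : Fin 3) : t i i = 1 := by
  obtain ⟨h1, h2, h3⟩ := (mem_Borel_iff t).1 ht
  have hpow : ∀ m : ℕ, (t ^ m) i i = t i i ^ m := by
    intro m
    induction m with
    | zero => simp
    | succ m ih =>
      obtain ⟨h4, h5, h6⟩ := (mem_Borel_iff _).1 (pow_mem ht m)
      rw [pow_succ, coe_mul_apply_three]
      fin_cases i
      · simpa [h1, h2, pow_succ] using Or.inl ih
      · simpa [h3, h4, pow_succ] using Or.inl ih
      · simpa [h5, h6, pow_succ] using Or.inl ih
  refine eq_one_of_pow_eq_one (p := p) (j := j) ?_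
  rw [← hpow, h, Units.val_one, one_apply_eq]

/-- An element of the Borel subgroup of `p`-power order outside the unipotent radical of `H_R` fixes
a unique flag refining the line stabilized by `H_R`. -/
theorem mem_Borel_of_conj_mem {t h : GL (Fin 3) k} (ht : t ∈ Borel k) {j : ℕ}
    (hj : t ^ p ^ j = 1) (htr : t ∉ unipotentRadical k) (hh : h ∈ H k)
    (hc : h⁻¹ * t * h ∈ Borel k) : h ∈ Borel k := by
  have hd := diag_eq_one_of_pow_eq_one ht hj
  have hj' : (h⁻¹ * t * h) ^ p ^ j = 1 := by
    have h1 : (h⁻¹ * t * h) = MulAut.conj h⁻¹ t := by simp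
    rw [h1, ← map_pow, hj, map_one]
  have hd' := diag_eq_one_of_pow_eq_one hc hj'
  have hth : t * h = h * (h⁻¹ * t * h) := by group
  generalize h⁻¹ * t * h = s at *
  have ht12 : t 1 2 ≠ 0 := fun h0 =>
    htr ((mem_unipotentRadical_iff t).2 ⟨ht, hd 0, hd 1, hd 2, h0⟩)
  obtain ⟨h1, h2⟩ := (mem_H_iff h).1 hh
  obtain ⟨t1, t2, t3⟩ := (mem_Borel_iff t).1 ht
  have h3 := congrArg (fun x : GL (Fin 3) k => x 1 1) hth
  simp only [coe_mul_apply_three, h1, t1, hd, hd', ((mem_Borel_iff s).1 hc).2.2] at h3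
  refine (mem_Borel_iff h).2 ⟨h1, h2, ?_⟩
  simpa [ht12] using h3

/-- The `p`-elements which centralize the unipotent radical of `H_R` lie in it: its centralizer
consists of the products of its elements with scalars. -/
theorem mem_unipotentRadical_of_commute {y : GL (Fin 3) k}
    (hc : ∀ r ∈ unipotentRadical k, r * y = y * r) {j : ℕ} (hj : y ^ p ^ j = 1) :
    y ∈ unipotentRadical k := by
  have h1 := hc _ (unitriangular_mem_unipotentRadical 1 0)
  have h2 := hc _ (unitriangular_mem_unipotentRadical 0 1)
  have e1 := fun i l => congrArg (fun x : GL (Fin 3) k => x i l) h1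
  have e2 := fun i l => congrArg (fun x : GL (Fin 3) k => x i l) h2
  simp only [coe_mul_apply_three, unitriangular_apply] at e1 e2
  have h10 : y 1 0 = 0 := by simpa using e1 0 0
  have h12 : y 1 2 = 0 := by simpa using e1 0 2
  have h20 : y 2 0 = 0 := by simpa using e2 0 0
  have h21 : y 2 1 = 0 := by simpa using e2 0 1
  have hB : y ∈ Borel k := (mem_Borel_iff y).2 ⟨h10, h20, h21⟩
  have hd := diag_eq_one_of_pow_eq_one hB hj
  exact (mem_unipotentRadical_iff y).2 ⟨hB, hd 0, hd 1, hd 2, h12⟩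

theorem mem_Borel_of_mul_eq_mul {z z' x : GL (Fin 3) k} (hz : z ∈ unipotentRadical k)
    (hz' : z' ∈ unipotentRadical k) (h : z 0 1 = 0) (h' : z' 0 1 = 0) (hz1 : z ≠ 1)
    (hx : x ∈ H k) (hc : z * x = x * z') : x ∈ Borel k := by
  obtain ⟨hB, z1, z2, z3, z4⟩ := (mem_unipotentRadical_iff z).1 hz
  obtain ⟨hB', y1, y2, y3, y4⟩ := (mem_unipotentRadical_iff z').1 hz'
  obtain ⟨z5, z6, z7⟩ := (mem_Borel_iff z).1 hB
  obtain ⟨y5, y6, y7⟩ := (mem_Borel_iff z').1 hB'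
  have hz02 : z 0 2 ≠ 0 := by
    intro h0
    refine hz1 (Units.ext ?_)
    ext i l
    fin_cases i <;> fin_cases l <;> simp [*]
  obtain ⟨h1, h2⟩ := (mem_H_iff x).1 hx
  refine (mem_Borel_iff x).2 ⟨h1, h2, ?_⟩
  have e := congrArg (fun x : GL (Fin 3) k => x 0 1) hc
  simpa [coe_mul_apply_three, h, h', z1, y2, y7, hz02] using e

theorem unitriangular_pow_eq_one (c : k) : unitriangular 0 0 c ^ p ^ 1 = 1 := by
  refine Units.ext ?_
  rw [Units.val_pow_eq_pow_val]
  refine pow_char_eq_one_of_sq_eq_zero ?_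
  rw [unitriangular_apply]
  ext i j
  fin_cases i <;> fin_cases j <;> simp [Matrix.mul_apply, Fin.sum_univ_three]

/-- As the elements of a `p`-group of matrices have trace `3`, such a group lies in the Borel
subgroup as soon as it contains a suitable transvection. -/
theorem mem_Borel_of_isPGroup {T : Subgroup (GL (Fin 3) k)} (hT : IsPGroup p T) (hTH : T ≤ H k)
    (h : unitriangular 0 0 1 ∈ T) : T ≤ Borel k := by
  intro t ht
  have htr : ∀ t ∈ T, (t : Matrix (Fin 3) (Fin 3) k).trace = (3 : ℕ) := by
    intro t ht
    obtain ⟨j, hj⟩ := hT ⟨t, ht⟩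
    refine trace_eq_of_pow_eq_one (p := p) (j := j) ?_
    rw [← Units.val_pow_eq_pow_val, show t ^ p ^ j = 1 from congrArg Subtype.val hj]
    rfl
  have h1 := htr t ht
  have h2 := htr _ (T.mul_mem h ht)
  rw [trace_fin_three] at h1 h2
  simp only [coe_mul_apply_three, unitriangular_apply] at h2
  obtain ⟨h3, h4⟩ := (mem_H_iff t).1 (hTH ht)
  refine (mem_Borel_iff t).2 ⟨h3, h4, ?_⟩
  simp at h2
  linear_combination h2 - h1

end FactorH

section Identification

variable {k : Type u} [Field k] {n : ℕ} {p : ℕ} [Fact p.Prime] [CharP k p]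
  {φ : NR k n ≃* Borel k}

/-- The identification `φ` of `N_G(R)` with the Borel subgroup maps `R` onto the unipotent radical
of `H_R`. -/
abbrev CarriesR (φ : NR k n ≃* Borel k) : Prop :=
  ∀ x : NR k n, (x : G k n) ∈ R k n ↔ (φ x : GL (Fin 3) k) ∈ unipotentRadical k

/-- The embedding of `N_G(R)` into `H_R`. -/
noncomputable abbrev toH (φ : NR k n ≃* Borel k) : NR k n →* H k :=
  (Subgroup.inclusion (Borel_le_H k)).comp φ.toMonoidHom

theorem toH_injective (φ : NR k n ≃* Borel k) : Function.Injective (toH φ) :=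
  (Subgroup.inclusion_injective (Borel_le_H k)).comp φ.injective

theorem coe_toH (b : NR k n) : (toH φ b : GL (Fin 3) k) = φ b := rfl

theorem mem_range_toH {x : H k} (hx : (x : GL (Fin 3) k) ∈ Borel k) : ∃ b, toH φ b = x :=
  ⟨φ.symm ⟨x, hx⟩, Subtype.ext (by rw [coe_toH, MulEquiv.apply_symm_apply])⟩

theorem exists_toH_eq_transvection (hn : 1 ≤ n) (hnp : n < p) (φ : NR k n ≃* Borel k) :
    ∃ b : NR k n, (b : G k n) ∈ S k n ∧ (φ b : GL (Fin 3) k) = unitriangular 0 0 1 := by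
  refine ⟨φ.symm ⟨_, unitriangular_mem_Borel 0 0 1⟩, ?_, by rw [MulEquiv.apply_symm_apply]⟩
  refine mem_S_of_mem_NR hn hnp (Subtype.prop _) (j := 1) ?_
  rw [← Subgroup.coe_pow, ← map_pow]
  have : (⟨unitriangular 0 0 1, unitriangular_mem_Borel 0 0 1⟩ : Borel k) ^ p ^ 1 = 1 :=
    Subtype.ext (unitriangular_pow_eq_one 1)
  rw [this, map_one]
  rfl

/-- The image in `H_R` of the Sylow `p`-subgroup `S ∩ N_G(R)` of `N_G(R)`. -/
noncomputable def sylowBorel (φ : NR k n ≃* Borel k) : Subgroup (H k) :=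
  ((S k n).subgroupOf (NR k n)).map (toH φ)

theorem exists_unitriangular_mem_sylowBorel (hn : 1 ≤ n) (hnp : n < p) (φ : NR k n ≃* Borel k) :
    ∃ x ∈ sylowBorel φ, (x : GL (Fin 3) k) = unitriangular 0 0 1 := by
  obtain ⟨b, hb, hb'⟩ := exists_toH_eq_transvection hn hnp φ
  exact ⟨_, ⟨b, hb, rfl⟩, hb'⟩

theorem sylowBorel_le {x : H k} (hx : x ∈ sylowBorel φ) : (x : GL (Fin 3) k) ∈ Borel k := by
  obtain ⟨b, -, rfl⟩ := hx
  exact (φ b).2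

/-- `S ∩ N_G(R)` as a Sylow `p`-subgroup of `H_R`. -/
noncomputable def sylowH (hn : 1 ≤ n) (hnp : n < p) (φ : NR k n ≃* Borel k) : Sylow p (H k) :=
  { sylowBorel φ with
    isPGroup' := (isPGroup_S (p := p)).comap_subtype.map _
    is_maximal' := fun {T} hT h => by
      refine le_antisymm (fun t ht => ?_) h
      obtain ⟨x, hx, hx'⟩ := exists_unitriangular_mem_sylowBorel hn hnp φ
      have hB := mem_Borel_of_isPGroup (hT.map (H k).subtype) (Subgroup.map_subtype_le T)
        ⟨x, h hx, hx'⟩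
      obtain ⟨b, rfl⟩ := mem_range_toH (φ := φ) (hB ⟨t, ht, rfl⟩)
      obtain ⟨j, hj⟩ := hT ⟨_, ht⟩
      refine ⟨b, mem_S_of_mem_NR hn hnp b.2 (j := j) ?_, rfl⟩
      have hj' : toH φ (b ^ p ^ j) = toH φ 1 := by
        rw [map_pow, map_one]
        exact congrArg Subtype.val hj
      exact congrArg Subtype.val (toH_injective φ hj') }

theorem exists_conj_mem_sylowBorel [Finite k] (hn : 1 ≤ n) (hnp : n < p) (φ : NR k n ≃* Borel k)
    {T : Subgroup (H k)} (hT : IsPGroup p T) : ∃ x, ∀ t ∈ T, x * t * x⁻¹ ∈ sylowBorel φ := by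
  obtain ⟨Q, hQ⟩ := hT.exists_le_sylow
  obtain ⟨x, hx⟩ := MulAction.exists_smul_eq (H k) Q (sylowH hn hnp φ)
  refine ⟨x, fun t ht => ?_⟩
  have h1 : x * t * x⁻¹ ∈ sylowH hn hnp φ := by
    rw [← hx]
    exact Subgroup.smul_mem_pointwise_smul _ (MulAut.conj x) _ (hQ ht)
  exact h1

theorem mem_range_toH_of_conj_mem (hφ : CarriesR φ) {b b' : NR k n} {j : ℕ}
    (hj : b ^ p ^ j = 1) (hb : (b : G k n) ∉ R k n) {x : H k}
    (hx : x⁻¹ * toH φ b * x = toH φ b') : ∃ c, toH φ c = x := by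
  refine mem_range_toH (mem_Borel_of_conj_mem (t := φ b) (φ b).2 (j := j) (p := p) ?_
    (fun h => hb ((hφ b).2 h)) x.2 ?_)
  · rw [← Subgroup.coe_pow, ← map_pow, hj, map_one]
    rfl
  · have h := congrArg Subtype.val hx
    change _ = (φ b' : GL (Fin 3) k) at h
    have h' : (x : GL (Fin 3) k)⁻¹ * φ b * x = φ b' := h
    rw [h']
    exact (φ b').2

theorem pPrimeResidual_sup_range_toH [Finite k] (hn : 1 ≤ n) (hnp : n < p) (φ : NR k n ≃* Borel k) :
    pPrimeResidual p (H k) ⊔ (toH φ).range = ⊤ := by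
  have hle : sylowBorel φ ≤ pPrimeResidual p (H k) := le_iSup (fun P : Sylow p (H k) =>
    (P : Subgroup (H k))) (sylowH hn hnp φ)
  have hF := Sylow.normalizer_sup_eq_top' (sylowH hn hnp φ) hle
  rw [eq_top_iff, ← hF]
  refine sup_le (fun g hg => ?_) le_sup_left
  obtain ⟨x, hx, hx'⟩ := exists_unitriangular_mem_sylowBorel hn hnp φ
  have h := (Subgroup.mem_normalizer_iff.1 (inv_mem hg) x).1 hx
  rw [inv_inv] at h
  refine Subgroup.mem_sup_right (mem_range_toH (mem_Borel_of_conj_mem (p := p) (j := 1)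
    (t := unitriangular 0 0 1) (unitriangular_mem_Borel 0 0 1) (unitriangular_pow_eq_one 1)
    (fun h => ?_) g.2 ?_))
  · simpa [unitriangular_apply] using ((mem_unipotentRadical_iff _).1 h).2.2.2.2
  · rw [← hx']
    exact sylowBorel_le h

/-- Since `Z` centralizes `S`, its image in the unipotent radical commutes with the transvection at
the position `(1,2)`, and thus consists of the matrices with a single entry above the diagonal, at
the position `(0,2)`. -/
theorem toH_apply_zero_one (hn : 1 ≤ n) (hnp : n < p) (hφ : CarriesR φ)
    {z : NR k n} (hz : (z : G k n) ∈ Z k n) : (φ z : GL (Fin 3) k) 0 1 = 0 := by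
  obtain ⟨b, hb, hb'⟩ := exists_toH_eq_transvection hn hnp φ
  have hzb : b * z = z * b := by
    obtain ⟨⟨w, hw⟩, hw', hwz⟩ := hz
    refine Subtype.ext ?_
    change (b : G k n) * z = z * b
    rw [← hwz]
    exact congrArg Subtype.val (Subgroup.mem_center_iff.1 hw' ⟨b, hb⟩)
  have h := congrArg (fun x => ((φ x : Borel k) : GL (Fin 3) k) 0 2) hzb
  obtain ⟨hB, h1, h2, h3, h4⟩ := (mem_unipotentRadical_iff _).1 ((hφ z).1 (Z_le_R hz))
  simpa [hb', coe_mul_apply_three, unitriangular_apply, h1, h3, h4] using h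

/-- Distinct `H_R`-conjugates of `Z` intersect trivially: they are the one-dimensional subspaces of
the natural module `R` for `GL₂(k)`. -/
theorem mem_range_toH_of_conj_mem_Z (hn : 1 ≤ n) (hnp : n < p) (hφ : CarriesR φ)
    {z z' : NR k n} (hz : (z : G k n) ∈ Z k n) (hz' : (z' : G k n) ∈ Z k n) (hz1 : z ≠ 1)
    {x : H k} (hx : x⁻¹ * toH φ z * x = toH φ z') : ∃ c, toH φ c = x := by
  refine mem_range_toH (mem_Borel_of_mul_eq_mul ((hφ z).1 (Z_le_R hz)) ((hφ z').1 (Z_le_R hz'))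
    (toH_apply_zero_one hn hnp hφ hz) (toH_apply_zero_one hn hnp hφ hz') ?_ x.2 ?_)
  · intro h
    exact hz1 (φ.injective (Subtype.ext (by rw [h, map_one]; rfl)))
  · have h : toH φ z * x = x * toH φ z' := by
      rw [← hx]
      group
    exact congrArg Subtype.val h

theorem exists_toH_eq_conj (hφ : CarriesR φ) {r : NR k n} (hr : (r : G k n) ∈ R k n) (x : H k) :
    ∃ r' : NR k n, (r' : G k n) ∈ R k n ∧ toH φ r' = x⁻¹ * toH φ r * x := by
  have h := conj_mem_unipotentRadical x.2 ((hφ r).1 hr)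
  obtain ⟨r', hr'⟩ := mem_range_toH (φ := φ) (x := x⁻¹ * toH φ r * x) (unipotentRadical_le_Borel h)
  refine ⟨r', (hφ r').2 ?_, hr'⟩
  rw [← coe_toH, hr']
  exact h

theorem exists_toH_eq_of_commute (hφ : CarriesR φ) {y : H k}
    (hc : ∀ r : NR k n, (r : G k n) ∈ R k n → toH φ r * y = y * toH φ r) {j : ℕ}
    (hj : y ^ p ^ j = 1) : ∃ r : NR k n, (r : G k n) ∈ R k n ∧ toH φ r = y := by
  have h : (y : GL (Fin 3) k) ∈ unipotentRadical k := by
    refine mem_unipotentRadical_of_commute (p := p) (j := j) (fun r hr => ?_) ?_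
    · have hr' := φ.apply_symm_apply ⟨r, unipotentRadical_le_Borel hr⟩
      have h1 := hc (φ.symm ⟨r, unipotentRadical_le_Borel hr⟩) ((hφ _).2 (by rwa [hr']))
      have h2 := congrArg Subtype.val h1
      simpa using h2
    · rw [← Subgroup.coe_pow, hj]
      rfl
  obtain ⟨r, rfl⟩ := mem_range_toH (φ := φ) (unipotentRadical_le_Borel h)
  exact ⟨r, (hφ r).2 h, rfl⟩

end Identification

end ClellandParker

/-! ### Normalizers in the amalgamated product -/

namespace ClellandParker

open Matrix MvPolynomial Monoid.PushoutI

section Conjugation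

variable {Γ : Type u} [Group Γ]

theorem conj_mul_eq (q x y : Γ) : (x * y)⁻¹ * q * (x * y) = y⁻¹ * (x⁻¹ * q * x) * y := by
  group

theorem exists_conj_pow_eq_one {p : ℕ} {q : Γ} (h : ∃ l, q ^ p ^ l = 1) (x : Γ) :
    ∃ l, (x⁻¹ * q * x) ^ p ^ l = 1 := by
  obtain ⟨l, hl⟩ := h
  refine ⟨l, ?_⟩
  have h1 : x⁻¹ * q * x = MulAut.conj x⁻¹ q := by simp
  rw [h1, ← map_pow, hl, map_one]

theorem conj_mem_of_mem_normalizer {Q : Subgroup Γ} {q x : Γ}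
    (hx : x ∈ Subgroup.normalizer (Q : Set Γ)) (hq : q ∈ Q) : x⁻¹ * q * x ∈ Q := by
  have h := (Subgroup.mem_normalizer_iff.1 (inv_mem hx) q).1 hq
  rwa [inv_inv] at h

end Conjugation

section Tree

variable {k : Type u} [Field k] {n : ℕ} {p : ℕ} [Fact p.Prime] [CharP k p]
  {φ : NR k n ≃* Borel k}

theorem factorMap_injective (φ : NR k n ≃* Borel k) : ∀ b, Function.Injective (factorMap φ b)
  | false => Subgroup.subtype_injective _
  | true => toH_injective φ

theorem ofG_injective (φ : NR k n ≃* Borel k) : Function.Injective (ofG φ) :=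
  of_injective (factorMap_injective φ) false

theorem ofH_injective (φ : NR k n ≃* Borel k) : Function.Injective (ofH φ) :=
  of_injective (factorMap_injective φ) true

/-- The image of `N_G(R)` in the amalgamated product. -/
noncomputable abbrev baseRange (φ : NR k n ≃* Borel k) : Subgroup (Amalgam φ) :=
  (base (factorMap φ)).range

theorem ofH_toH (b : NR k n) : ofH φ (toH φ b) = ofG φ b :=
  (of_apply_eq_base (factorMap φ) true b).trans (of_apply_eq_base (factorMap φ) false b).symm

theorem mem_baseRange_iff {x : Amalgam φ} : x ∈ baseRange φ ↔ ∃ b : NR k n, ofG φ b = x := by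
  have h : ∀ b, base (factorMap φ) b = ofG φ b := fun b =>
    (of_apply_eq_base (factorMap φ) false b).symm
  constructor
  · rintro ⟨b, rfl⟩
    exact ⟨b, (h b).symm⟩
  · rintro ⟨b, rfl⟩
    exact ⟨b, h b⟩

theorem mem_NR_of_mem_R {g : G k n} (hg : g ∈ R k n) : g ∈ NR k n := Subgroup.le_normalizer hg

theorem conj_mem_map_R (hφ : CarriesR φ) {q x : Amalgam φ} (hq : q ∈ (R k n).map (ofG φ))
    (hx : x ∈ (ofH φ).range) : x⁻¹ * q * x ∈ (R k n).map (ofG φ) := by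
  obtain ⟨r, hr, rfl⟩ := hq
  obtain ⟨x, rfl⟩ := hx
  obtain ⟨r', hr', h⟩ := exists_toH_eq_conj hφ (r := ⟨r, mem_NR_of_mem_R hr⟩) hr x
  refine ⟨r', hr', ?_⟩
  rw [← ofH_toH, h, map_mul, map_mul, map_inv, ofH_toH]

theorem mem_baseRange_of_conj_mem_R [Finite k] (hn : 1 ≤ n) (hnp : n < p) {q x : Amalgam φ}
    (hq : q ∈ (R k n).map (ofG φ)) (hqZ : q ∉ (Z k n).map (ofG φ)) (hx : x ∈ (ofG φ).range)
    (h : x⁻¹ * q * x ∈ (R k n).map (ofG φ)) : x ∈ baseRange φ := by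
  obtain ⟨q, hq, rfl⟩ := hq
  obtain ⟨x, rfl⟩ := hx
  rw [← map_inv, ← map_mul, ← map_mul, Subgroup.mem_map_iff_mem (ofG_injective φ)] at h
  rw [Subgroup.mem_map_iff_mem (ofG_injective φ)] at hqZ
  exact mem_baseRange_iff.2 ⟨⟨x, mem_NR_of_conj_mem_R hn hnp hq hqZ h⟩, rfl⟩

theorem conj_mem_map_Z (hn : 1 ≤ n) (hnp : n < p) {q x : Amalgam φ}
    (hq : q ∈ (Z k n).map (ofG φ)) (hx : x ∈ (ofG φ).range)
    (h : x⁻¹ * q * x ∈ (R k n).map (ofG φ)) : x⁻¹ * q * x ∈ (Z k n).map (ofG φ) := by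
  obtain ⟨q, hq, rfl⟩ := hq
  obtain ⟨x, rfl⟩ := hx
  rw [← map_inv, ← map_mul, ← map_mul, Subgroup.mem_map_iff_mem (ofG_injective φ)] at h ⊢
  refine mem_Z_of_mem_R hn hnp h ?_
  simp [right_eq_one_of_mem_Z hn hnp hq]

theorem mem_baseRange_of_conj_mem_Z (hn : 1 ≤ n) (hnp : n < p) (hφ : CarriesR φ)
    {q x : Amalgam φ} (hq : q ∈ (Z k n).map (ofG φ)) (hq1 : q ≠ 1) (hx : x ∈ (ofH φ).range)
    (h : x⁻¹ * q * x ∈ (Z k n).map (ofG φ)) : x ∈ baseRange φ := by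
  obtain ⟨q, hq, rfl⟩ := hq
  obtain ⟨x, rfl⟩ := hx
  obtain ⟨q', hq', h⟩ := h
  obtain ⟨c, rfl⟩ := mem_range_toH_of_conj_mem_Z hn hnp hφ
    (z := ⟨q, mem_NR_of_mem_R (Z_le_R hq)⟩) (z' := ⟨q', mem_NR_of_mem_R (Z_le_R hq')⟩) hq hq'
    (fun h1 => hq1 (by rw [show q = 1 from congrArg Subtype.val h1, map_one])) (x := x) (by
      refine ofH_injective φ ?_
      rw [map_mul, map_mul, map_inv, ofH_toH, ofH_toH]
      exact h.symm)
  exact mem_baseRange_iff.2 ⟨c, (ofH_toH c).symm⟩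

theorem mem_baseRange_of_conj_mem_baseRange (hφ : CarriesR φ)
    {q x : Amalgam φ} (hq : q ∈ baseRange φ) (hqR : q ∉ (R k n).map (ofG φ)) {j : ℕ}
    (hj : q ^ p ^ j = 1) (hx : x ∈ (ofH φ).range) (h : x⁻¹ * q * x ∈ baseRange φ) :
    x ∈ baseRange φ := by
  obtain ⟨q, rfl⟩ := mem_baseRange_iff.1 hq
  obtain ⟨x, rfl⟩ := hx
  obtain ⟨q', h⟩ := mem_baseRange_iff.1 h
  rw [Subgroup.mem_map_iff_mem (ofG_injective φ)] at hqR
  obtain ⟨c, rfl⟩ := mem_range_toH_of_conj_mem (b := q) (b' := q') (j := j) (p := p) hφ (by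
      rw [← map_pow] at hj
      exact Subtype.ext (ofG_injective φ (hj.trans (map_one _).symm))) hqR (x := x) (by
      refine ofH_injective φ ?_
      rw [map_mul, map_mul, map_inv, ofH_toH, ofH_toH]
      exact h.symm)
  exact mem_baseRange_iff.2 ⟨c, (ofH_toH c).symm⟩

/-- If a `p`-element of `G` outside `R` fixes a path in the Bass-Serre tree that starts at the
vertex `G` with the edge to `H_R`, then this path ends at the vertex `H_R`. -/
theorem conj_notMem_range_of_altWord (hφ : CarriesR φ) {q x : Amalgam φ} {j : Bool}
    (hq : q ∈ (ofG φ).range) (hqR : q ∉ (R k n).map (ofG φ)) (hqp : ∃ l, q ^ p ^ l = 1)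
    (hx : AltWord true j x) : x⁻¹ * q * x ∉ (ofG φ).range := by
  intro h
  obtain ⟨l, hl⟩ := hqp
  have hqb : q ∈ baseRange φ :=
    AltWord.mem_base_of_conj_mem (factorMap_injective φ) (i := false) (l := false) hx hq h
  have hqH : q ∈ (ofH φ).range := base_range_le true hqb
  cases hx with
  | letter _ _ hx hb =>
    refine hb (mem_baseRange_of_conj_mem_baseRange hφ hqb hqR hl hx ?_)
    exact (inf_of_range_eq_base_range (factorMap_injective φ) (i := false) (j := true)
      (by decide)).le (Subgroup.mem_inf.2 ⟨h, mul_mem (mul_mem (inv_mem hx) hqH) hx⟩)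
  | cons _ _ x y hx hb hy =>
    refine hb (mem_baseRange_of_conj_mem_baseRange hφ hqb hqR hl hx ?_)
    rw [conj_mul_eq] at h
    exact AltWord.mem_base_of_conj_mem (factorMap_injective φ) (i := true) (l := false) hy
      (mul_mem (mul_mem (inv_mem hx) hqH) hx) h

theorem exists_pow_eq_one_of_mem_R (hn : 1 ≤ n) (hnp : n < p) {q : Amalgam φ}
    (hq : q ∈ (R k n).map (ofG φ)) : ∃ l, q ^ p ^ l = 1 := by
  obtain ⟨q, hq, rfl⟩ := hq
  obtain ⟨l, hl⟩ := isPGroup_S (p := p) ⟨q, R_le_S hn hnp hq⟩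
  exact ⟨l, by rw [← map_pow, show q ^ p ^ l = 1 from congrArg Subtype.val hl, map_one]⟩

/-- An element of `R \ Z` belongs to none of the conjugates of `R` attached to those vertices of the
Bass-Serre tree which are reached from the vertex `H_R` through the vertex `G`. -/
theorem conj_notMem_R_of_altWord [Finite k] (hn : 1 ≤ n) (hnp : n < p) (hφ : CarriesR φ)
    {q x : Amalgam φ} {j : Bool} (hq : q ∈ (R k n).map (ofG φ)) (hqZ : q ∉ (Z k n).map (ofG φ))
    (hx : AltWord false j x) : x⁻¹ * q * x ∉ (R k n).map (ofG φ) := by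
  intro h
  have hle : (R k n).map (ofG φ) ≤ (ofG φ).range := Subgroup.map_le_range _ _
  cases hx with
  | letter _ _ hx hb => exact hb (mem_baseRange_of_conj_mem_R hn hnp hq hqZ hx h)
  | cons _ _ x y hx hb hy =>
    refine conj_notMem_range_of_altWord hφ (mul_mem (mul_mem (inv_mem hx) (hle hq)) hx)
      (fun h1 => hb (mem_baseRange_of_conj_mem_R hn hnp hq hqZ hx h1))
      (exists_conj_pow_eq_one (exists_pow_eq_one_of_mem_R hn hnp hq) x) hy ?_
    rw [conj_mul_eq] at h
    exact hle h

/-- A nontrivial element of `Z` is conjugated out of `Z` by each reduced word which starts in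
`H_R`. -/
theorem conj_notMem_Z_of_altWord [Finite k] (hn : 1 ≤ n) (hnp : n < p) (hφ : CarriesR φ)
    {q x : Amalgam φ} {j : Bool} (hq : q ∈ (Z k n).map (ofG φ)) (hq1 : q ≠ 1)
    (hx : AltWord true j x) : x⁻¹ * q * x ∉ (Z k n).map (ofG φ) := by
  intro h
  cases hx with
  | letter _ _ hx hb => exact hb (mem_baseRange_of_conj_mem_Z hn hnp hφ hq hq1 hx h)
  | cons _ _ x y hx hb hy =>
    refine conj_notMem_R_of_altWord hn hnp hφ
      (conj_mem_map_R hφ (Subgroup.map_mono Z_le_R hq) hx)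
      (fun h1 => hb (mem_baseRange_of_conj_mem_Z hn hnp hφ hq hq1 hx h1)) hy ?_
    rw [conj_mul_eq] at h
    exact Subgroup.map_mono Z_le_R h

theorem normalizer_le_of_not_conj_le_R (hφ : CarriesR φ) {Q : Subgroup (Amalgam φ)}
    (hQp : IsPGroup p Q) (hQ : Q ≤ (ofG φ).range)
    (hR : ∀ x ∈ (ofG φ).range, ∃ q ∈ Q, x⁻¹ * q * x ∉ (R k n).map (ofG φ)) :
    Subgroup.normalizer (Q : Set (Amalgam φ)) ≤ (ofG φ).range := by
  intro x hx
  have hpow : ∀ q ∈ Q, ∃ l, q ^ p ^ l = 1 := fun q hq => by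
    obtain ⟨l, hl⟩ := hQp ⟨q, hq⟩
    exact ⟨l, congrArg Subtype.val hl⟩
  rcases mem_base_or_altWord x with hb | ⟨i, j, hw⟩
  · exact base_range_le false hb
  cases i with
  | true =>
    obtain ⟨q, hq, hqR⟩ := hR 1 (one_mem _)
    refine absurd (hQ (conj_mem_of_mem_normalizer hx hq))
      (conj_notMem_range_of_altWord hφ (hQ hq) ?_ (hpow q hq) hw)
    simpa using hqR
  | false =>
    cases hw with
    | letter _ _ hx' _ => exact hx'
    | cons _ _ x y hx' hb hy =>
      obtain ⟨q, hq, hqR⟩ := hR x hx'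
      refine absurd (hQ (conj_mem_of_mem_normalizer hx hq)) ?_
      have h := conj_notMem_range_of_altWord hφ (mul_mem (mul_mem (inv_mem hx') (hQ hq)) hx') hqR
        (exists_conj_pow_eq_one (hpow q hq) x) hy
      rwa [conj_mul_eq]

theorem normalizer_le_of_le_Z [Finite k] (hn : 1 ≤ n) (hnp : n < p) (hφ : CarriesR φ)
    {Q : Subgroup (Amalgam φ)} (hQ : Q ≤ (Z k n).map (ofG φ)) (hQ1 : Q ≠ ⊥) :
    Subgroup.normalizer (Q : Set (Amalgam φ)) ≤ (ofG φ).range := by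
  intro x hx
  obtain ⟨q, hq, hq1⟩ := (Subgroup.ne_bot_iff_exists_ne_one.1 hQ1)|>.elim fun q h =>
    (⟨q, q.2, fun h1 => h (Subtype.ext h1)⟩ : ∃ q : Amalgam φ, q ∈ Q ∧ q ≠ 1)
  have hqG := Subgroup.map_le_range (ofG φ) _ (hQ hq)
  have hqx := conj_mem_of_mem_normalizer hx hq
  rcases mem_base_or_altWord x with hb | ⟨i, j, hw⟩
  · exact base_range_le false hb
  cases i with
  | true => exact absurd (hQ hqx) (conj_notMem_Z_of_altWord hn hnp hφ (hQ hq) hq1 hw)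
  | false =>
    cases hw with
    | letter _ _ hx' _ => exact hx'
    | cons _ _ x y hx' hb hy =>
      rw [conj_mul_eq] at hqx
      by_cases hR : x⁻¹ * q * x ∈ (R k n).map (ofG φ)
      · refine absurd (hQ hqx) (conj_notMem_Z_of_altWord hn hnp hφ
          (conj_mem_map_Z hn hnp (hQ hq) hx' hR) (fun h1 => hq1 ?_) hy)
        have h2 : q = x * (x⁻¹ * q * x) * x⁻¹ := by group
        rw [h2, h1]
        group
      · exact absurd (Subgroup.map_le_range (ofG φ) _ (hQ hqx))
          (conj_notMem_range_of_altWord hφ (mul_mem (mul_mem (inv_mem hx') hqG) hx') hR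
            (exists_conj_pow_eq_one (exists_pow_eq_one_of_mem_R hn hnp
              (Subgroup.map_mono Z_le_R (hQ hq))) x) hy)

theorem normalizer_le_of_le_R [Finite k] (hn : 1 ≤ n) (hnp : n < p) (hφ : CarriesR φ)
    {Q : Subgroup (Amalgam φ)} (hQ : Q ≤ (R k n).map (ofG φ))
    (hZ : ∀ x ∈ (ofH φ).range, ∃ q ∈ Q, x⁻¹ * q * x ∉ (Z k n).map (ofG φ)) :
    Subgroup.normalizer (Q : Set (Amalgam φ)) ≤ (ofH φ).range := by
  intro x hx
  rcases mem_base_or_altWord x with hb | ⟨i, j, hw⟩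
  · exact base_range_le true hb
  cases i with
  | false =>
    obtain ⟨q, hq, hqZ⟩ := hZ 1 (one_mem _)
    refine absurd (hQ (conj_mem_of_mem_normalizer hx hq))
      (conj_notMem_R_of_altWord hn hnp hφ (hQ hq) ?_ hw)
    simpa using hqZ
  | true =>
    cases hw with
    | letter _ _ hx' _ => exact hx'
    | cons _ _ x y hx' hb hy =>
      obtain ⟨q, hq, hqZ⟩ := hZ x hx'
      refine absurd (hQ (conj_mem_of_mem_normalizer hx hq)) ?_
      have h := conj_notMem_R_of_altWord hn hnp hφ (conj_mem_map_R hφ (hQ hq) hx') hqZ hy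
      rwa [conj_mul_eq]

end Tree

end ClellandParker

/-! ### The normal `p`-subgroups of normalizers and the fusion system -/

open FusionSystem

section LocalStructure

variable {K Γ : Type u} [Group K] [Group Γ]

/-- The normalizer of `Q` has a normal `p`-subgroup which contains all elements of `p`-power order
of the normalizer by which it is centralized. -/
def HasCentricNormalSubgroup (p : ℕ) (Q : Subgroup Γ) : Prop :=
  ∃ X ≤ Subgroup.normalizer (Q : Set Γ), IsPGroup p X ∧
    Subgroup.normalizer (Q : Set Γ) ≤ Subgroup.normalizer (X : Set Γ) ∧
    ∀ y ∈ Subgroup.normalizer (Q : Set Γ), y ∈ Subgroup.centralizer (X : Set Γ) →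
      (∃ j, y ^ p ^ j = 1) → y ∈ X

/-- The properties of the normalizer of `Q` needed for the saturation of the fusion system over `P`
and for the normalizer of `Q` in it to be constrained. -/
structure HasGoodNormalizer (p : ℕ) (P Q : Subgroup Γ) : Prop where
  finite : Finite (Subgroup.normalizer (Q : Set Γ))
  conj : ∀ T ≤ Subgroup.normalizer (Q : Set Γ), IsPGroup p T → ∃ g, ∀ t ∈ T, g * t * g⁻¹ ∈ P
  centric : HasCentricNormalSubgroup p Q

theorem HasCentricNormalSubgroup.map {p : ℕ} {f : K →* Γ} (hf : Function.Injective f)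
    {Q : Subgroup K} (h : HasCentricNormalSubgroup p Q)
    (hN : Subgroup.normalizer ((Q.map f : Subgroup Γ) : Set Γ) ≤ f.range) :
    HasCentricNormalSubgroup p (Q.map f) := by
  obtain ⟨X, hXN, hXp, hNX, hXc⟩ := h
  refine ⟨X.map f, ?_, hXp.map f, fun y hy => ?_, fun y hy hyX hyp => ?_⟩
  · rintro _ ⟨x, hx, rfl⟩
    exact (mem_normalizer_map_iff hf Q x).2 (hXN hx)
  · obtain ⟨y, rfl⟩ := hN hy
    exact (mem_normalizer_map_iff hf X y).2 (hNX ((mem_normalizer_map_iff hf Q y).1 hy))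
  · obtain ⟨y, rfl⟩ := hN hy
    obtain ⟨j, hj⟩ := hyp
    refine ⟨y, hXc y ((mem_normalizer_map_iff hf Q y).1 hy) ?_ ⟨j, hf ?_⟩, rfl⟩
    · refine Subgroup.mem_centralizer_iff.2 fun x hx => hf ?_
      rw [map_mul, map_mul]
      exact Subgroup.mem_centralizer_iff.1 hyX _ ⟨x, hx, rfl⟩
    · rw [map_pow, hj, map_one]

theorem hasGoodNormalizer_map {p : ℕ} {f : K →* Γ} (hf : Function.Injective f) [Finite K]
    {P : Subgroup Γ} (hconj : ∀ T : Subgroup K, IsPGroup p T → ∃ g, ∀ t ∈ T, g * f t * g⁻¹ ∈ P)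
    {Q : Subgroup K} (h : HasCentricNormalSubgroup p Q)
    (hN : Subgroup.normalizer ((Q.map f : Subgroup Γ) : Set Γ) ≤ f.range) :
    HasGoodNormalizer p P (Q.map f) := by
  refine ⟨?_, fun T hT hTp => ?_, h.map hf hN⟩
  · have : Finite f.range := Finite.of_surjective _ f.rangeRestrict_surjective
    exact Finite.of_injective _ (Subgroup.inclusion_injective hN)
  · obtain ⟨g, hg⟩ := hconj (T.comap f) (hTp.comap_of_injective f hf)
    refine ⟨g, fun t ht => ?_⟩
    obtain ⟨t, rfl⟩ := hN (hT ht)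
    exact hg t ht

theorem HasGoodNormalizer.of_conj {p : ℕ} {P Q : Subgroup Γ} {x : Γ}
    (h : HasGoodNormalizer p P (Q.map (MulAut.conj x).toMonoidHom)) : HasGoodNormalizer p P Q := by
  have hQ : (Q.map (MulAut.conj x).toMonoidHom).map (MulAut.conj x⁻¹).toMonoidHom = Q := by
    rw [Subgroup.map_map]
    convert Subgroup.map_id Q
    ext y
    simp [mul_assoc]
  have hN : Subgroup.normalizer (Q : Set Γ) =
      (Subgroup.normalizer ((Q.map (MulAut.conj x).toMonoidHom : Subgroup Γ) : Set Γ)).map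
        (MulAut.conj x⁻¹).toMonoidHom := by
    conv_lhs => rw [← hQ]
    exact (Subgroup.map_equiv_normalizer_eq _ (MulAut.conj x⁻¹)).symm
  refine ⟨?_, fun T hT hTp => ?_, ?_⟩
  · rw [hN]
    have := h.finite
    exact Finite.of_equiv _ (Subgroup.equivMapOfInjective _ _ (MulAut.conj x⁻¹).injective).toEquiv
  · obtain ⟨g, hg⟩ := h.conj (T.map (MulAut.conj x).toMonoidHom) (by
      rintro _ ⟨t, ht, rfl⟩
      exact (mem_normalizer_map_iff (MulAut.conj x).injective Q t).2 (hT ht)) (hTp.map _)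
    refine ⟨g * x, fun t ht => ?_⟩
    convert hg _ ⟨t, ht, rfl⟩ using 1
    simp [mul_assoc]
  · have := h.centric.map (f := (MulAut.conj x⁻¹).toMonoidHom) (MulAut.conj x⁻¹).injective (by
      rw [MonoidHom.range_eq_top.2 (MulAut.conj x⁻¹).surjective]
      exact le_top)
    rwa [hQ] at this

end LocalStructure

namespace ClellandParker

section Factors

variable {k : Type u} [Field k] {n : ℕ} {p : ℕ} [Fact p.Prime] [CharP k p]

theorem mul_comm_of_right_eq_one {x y : G k n} (hx : x.right = 1) (hy : y.right = 1) :
    x * y = y * x := by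
  refine ext_polyPart ?_ (by simp [hx, hy])
  rw [polyPart_mul, polyPart_mul, hx, hy]
  simp [subst_one, add_comm]

theorem mul_comm_of_mem_U {d e : D k} (hd : d ∈ U k) (he : e ∈ U k) : d * e = e * d := by
  obtain ⟨h1, h2, h3, h4⟩ := hd
  obtain ⟨e1, e2, e3, e4⟩ := he
  refine Prod.ext (mul_comm _ _) (Units.ext ?_)
  ext i j
  have := coe_mul_apply d.2 e.2 i j
  have := coe_mul_apply e.2 d.2 i j
  fin_cases i <;> fin_cases j <;> simp_all [add_comm]

theorem mul_comm_of_mem_R (hn : 1 ≤ n) (hnp : n < p) {x y : G k n} (hx : x ∈ R k n)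
    (hy : y ∈ R k n) : x * y = y * x := by
  obtain ⟨hxS, a, ha⟩ := (mem_R_iff_of_lt hn hnp x).1 hx
  obtain ⟨hyS, b, hb⟩ := (mem_R_iff_of_lt hn hnp y).1 hy
  refine ext_polyPart ?_ (mul_comm_of_mem_U hxS hyS)
  rw [polyPart_mul, polyPart_mul, ha, hb, subst_X_zero_pow_of_mem_U (right_mem_U hxS),
    subst_X_zero_pow_of_mem_U (right_mem_U hyS), (right_mem_U hxS).1, (right_mem_U hyS).1]
  simp [add_comm]

/-- For a subgroup of `A` the normal subgroup is `A`; for a subgroup `Q` of `S` outside `A` it is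
`Q C_S(Q)`, since `C_S(Q)` consists of all elements of `p`-power order of `C_G(Q)`. -/
theorem hasCentricNormalSubgroup_G (hn : 1 ≤ n) {Q : Subgroup (G k n)} (hQ : Q ≤ S k n) :
    HasCentricNormalSubgroup p Q := by
  by_cases hA : ∀ q ∈ Q, q.right = 1
  · let A' : Subgroup (G k n) := (SemidirectProduct.rightHom (φ := act k n)).ker
    have hA' : ∀ a, a ∈ A' ↔ a.right = 1 := fun a => Iff.rfl
    have hnormal : Subgroup.normalizer (A' : Set (G k n)) = ⊤ := Subgroup.normalizer_eq_top _
    refine ⟨A', fun a ha => ?_, ?_, ?_, ?_⟩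
    · refine Subgroup.centralizer_le_normalizer _ (Subgroup.mem_centralizer_iff.2 fun q hq => ?_)
      exact mul_comm_of_right_eq_one (hA q hq) ha
    · exact fun a => ⟨1, Subtype.ext (pow_char_eq_one_of_right_eq_one a.2)⟩
    · rw [hnormal]
      exact le_top
    · rintro y - hy ⟨j, hj⟩
      exact right_eq_one_of_commute hn (fun a ha => Subgroup.mem_centralizer_iff.1 hy a ha) hj
  · push Not at hA
    obtain ⟨q, hq, hq1⟩ := hA
    have hmem : ∀ y, y ∈ Subgroup.centralizer (Q : Set (G k n)) ⊓ S k n ↔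
        y ∈ Subgroup.centralizer (Q : Set (G k n)) ∧ ∃ j, y ^ p ^ j = 1 := by
      intro y
      rw [Subgroup.mem_inf]
      refine and_congr_right fun hy => ⟨fun hyS => ?_, fun ⟨j, hj⟩ => ?_⟩
      · obtain ⟨j, hj⟩ := isPGroup_S (p := p) ⟨y, hyS⟩
        exact ⟨j, congrArg Subtype.val hj⟩
      · exact mem_S_of_commute (hQ hq) hq1 (Subgroup.mem_centralizer_iff.1 hy q hq) hj
    have hnorm : Subgroup.normalizer (Q : Set (G k n)) ≤ Subgroup.normalizer
        ((Subgroup.centralizer (Q : Set (G k n)) ⊓ S k n : Subgroup (G k n)) : Set (G k n)) := by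
      have hconj : ∀ g ∈ Subgroup.normalizer (Q : Set (G k n)),
          ∀ y ∈ Subgroup.centralizer (Q : Set (G k n)) ⊓ S k n,
          g * y * g⁻¹ ∈ Subgroup.centralizer (Q : Set (G k n)) ⊓ S k n := by
        intro g hg y hy
        obtain ⟨hyc, hyp⟩ := (hmem y).1 hy
        refine (hmem _).2 ⟨Subgroup.mem_centralizer_iff.2 fun x hx => ?_, ?_⟩
        · have h1 := Subgroup.mem_centralizer_iff.1 hyc _ (conj_mem_of_mem_normalizer hg hx)
          calc x * (g * y * g⁻¹) = g * ((g⁻¹ * x * g) * y) * g⁻¹ := by group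
            _ = g * y * g⁻¹ * x := by rw [h1]; group
        · simpa using exists_conj_pow_eq_one hyp g⁻¹
      intro g hg
      refine Subgroup.mem_normalizer_iff.2 fun y => ⟨hconj g hg y, fun hy => ?_⟩
      simpa [mul_assoc] using hconj g⁻¹ (inv_mem hg) _ hy
    refine ⟨Q ⊔ (Subgroup.centralizer (Q : Set (G k n)) ⊓ S k n), ?_, ?_, fun g hg => ?_, ?_⟩
    · exact sup_le Subgroup.le_normalizer (inf_le_left.trans (Subgroup.centralizer_le_normalizer _))
    · exact isPGroup_of_le isPGroup_S (sup_le hQ inf_le_right)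
    · have hle : ∀ {g : G k n}, g ∈ Subgroup.normalizer (Q : Set (G k n)) →
          Q ⊔ (Subgroup.centralizer (Q : Set (G k n)) ⊓ S k n) ≤
          (Q ⊔ (Subgroup.centralizer (Q : Set (G k n)) ⊓ S k n)).comap
            (MulAut.conj g).toMonoidHom := fun {g} hg => sup_le
        (fun x hx => Subgroup.mem_sup_left ((Subgroup.mem_normalizer_iff.1 hg x).1 hx))
        (fun x hx => Subgroup.mem_sup_right ((Subgroup.mem_normalizer_iff.1 (hnorm hg) x).1 hx))
      refine Subgroup.mem_normalizer_iff.2 fun y => ⟨fun hy => hle hg hy, fun hy => ?_⟩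
      simpa [mul_assoc] using hle (inv_mem hg) hy
    · rintro y - hy hyp
      refine Subgroup.mem_sup_right ((hmem y).2 ⟨?_, hyp⟩)
      exact Subgroup.centralizer_le (fun x hx => Subgroup.mem_sup_left hx) hy

variable {φ : NR k n ≃* Borel k}

/-- For a subgroup of `R` the normal subgroup is `R`. -/
theorem hasCentricNormalSubgroup_H (hn : 1 ≤ n) (hnp : n < p) (hφ : CarriesR φ)
    {Q : Subgroup (H k)} (hQ : Q ≤ ((R k n).subgroupOf (NR k n)).map (toH φ)) :
    HasCentricNormalSubgroup p Q := by
  have hconj : ∀ g : H k, ∀ x ∈ ((R k n).subgroupOf (NR k n)).map (toH φ),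
      g * x * g⁻¹ ∈ ((R k n).subgroupOf (NR k n)).map (toH φ) := by
    rintro g _ ⟨r, hr, rfl⟩
    obtain ⟨r', hr', h⟩ := exists_toH_eq_conj hφ hr g⁻¹
    exact ⟨r', hr', by rw [h, inv_inv]⟩
  refine ⟨((R k n).subgroupOf (NR k n)).map (toH φ), fun x hx => ?_, ?_, fun g _ => ?_, ?_⟩
  · refine Subgroup.centralizer_le_normalizer _ (Subgroup.mem_centralizer_iff.2 fun q hq => ?_)
    obtain ⟨r, hr, rfl⟩ := hx
    obtain ⟨s, hs, rfl⟩ := hQ hq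
    rw [← map_mul, ← map_mul]
    exact congrArg _ (Subtype.ext (mul_comm_of_mem_R hn hnp hs hr))
  · exact (isPGroup_of_le (isPGroup_S (p := p)) (R_le_S hn hnp)).comap_subtype.map _
  · refine Subgroup.mem_normalizer_iff.2 fun y => ⟨hconj g y, fun hy => ?_⟩
    simpa [mul_assoc] using hconj g⁻¹ _ hy
  · rintro y - hy ⟨j, hj⟩
    obtain ⟨r, hr, rfl⟩ := exists_toH_eq_of_commute hφ
      (fun r hr => Subgroup.mem_centralizer_iff.1 hy _ ⟨r, hr, rfl⟩) hj
    exact ⟨r, hr, rfl⟩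

end Factors

section Amalgam

variable {k : Type u} [Field k] {n : ℕ} {p : ℕ} [Fact p.Prime] [CharP k p]
  {φ : NR k n ≃* Borel k}

theorem exists_conj_ofG_mem [Finite k] (φ : NR k n ≃* Borel k) (T : Subgroup (G k n))
    (hT : IsPGroup p T) :
    ∃ g, ∀ t ∈ T, g * ofG φ t * g⁻¹ ∈ (S k n).map (ofG φ) := by
  have hfin : Finite (G k n) := finite_G
  obtain ⟨Q, hQ⟩ := hT.exists_le_sylow
  obtain ⟨x, hx⟩ := MulAction.exists_smul_eq (G k n) Q (sylowS p)
  refine ⟨ofG φ x, fun t ht => ⟨x * t * x⁻¹, ?_, by simp⟩⟩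
  have h1 : x * t * x⁻¹ ∈ (sylowS p : Sylow p (G k n)) := by
    rw [← hx]
    exact Subgroup.smul_mem_pointwise_smul _ (MulAut.conj x) _ (hQ ht)
  exact h1

theorem exists_conj_ofH_mem [Finite k] (hn : 1 ≤ n) (hnp : n < p) (φ : NR k n ≃* Borel k)
    (T : Subgroup (H k)) (hT : IsPGroup p T) :
    ∃ g, ∀ t ∈ T, g * ofH φ t * g⁻¹ ∈ (S k n).map (ofG φ) := by
  obtain ⟨x, hx⟩ := exists_conj_mem_sylowBorel hn hnp φ hT
  refine ⟨ofH φ x, fun t ht => ?_⟩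
  obtain ⟨b, hb, hbt⟩ := hx t ht
  exact ⟨b, hb, by rw [← ofH_toH, hbt, map_mul, map_mul, map_inv]⟩

/-- Every nontrivial subgroup of `S` is conjugate in the amalgamated product to one whose normalizer
lies in a factor: to one of which no `G`-conjugate lies in `R`, to a subgroup of `Z`, or to a
subgroup of `R` of which no `H_R`-conjugate lies in `Z`. -/
theorem hasGoodNormalizer [Finite k] (hn : 1 ≤ n) (hnp : n < p) (hφ : CarriesR φ)
    {Q : Subgroup (Amalgam φ)} (hQ : Q ≤ (S k n).map (ofG φ)) (hQ1 : Q ≠ ⊥) :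
    HasGoodNormalizer p ((S k n).map (ofG φ)) Q := by
  have hfin : Finite (G k n) := finite_G
  have hSp : IsPGroup p ((S k n).map (ofG φ)) := isPGroup_S.map _
  have conj_le : ∀ {V W : Subgroup (Amalgam φ)} {x : Amalgam φ}, (∀ q ∈ V, x⁻¹ * q * x ∈ W) →
      V.map (MulAut.conj x⁻¹).toMonoidHom ≤ W := by
    rintro V W x h _ ⟨q, hq, rfl⟩
    simpa using h q hq
  have hG : ∀ V : Subgroup (Amalgam φ), V ≤ (S k n).map (ofG φ) →
      Subgroup.normalizer (V : Set (Amalgam φ)) ≤ (ofG φ).range →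
      HasGoodNormalizer p ((S k n).map (ofG φ)) V := by
    intro V hV hN
    have hV' : (V.comap (ofG φ)).map (ofG φ) = V :=
      Subgroup.map_comap_eq_self (hV.trans (Subgroup.map_le_range _ _))
    rw [← hV'] at hN ⊢
    refine hasGoodNormalizer_map (ofG_injective φ) (exists_conj_ofG_mem φ)
      (hasCentricNormalSubgroup_G hn fun q hq => ?_) hN
    exact (Subgroup.mem_map_iff_mem (ofG_injective φ)).1 (hV hq)
  by_cases h1 : ∃ x ∈ (ofG φ).range, ∀ q ∈ Q, x⁻¹ * q * x ∈ (R k n).map (ofG φ)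
  swap
  · push Not at h1
    exact hG Q hQ (normalizer_le_of_not_conj_le_R hφ (isPGroup_of_le hSp hQ)
      (hQ.trans (Subgroup.map_le_range _ _)) h1)
  obtain ⟨x, -, hx⟩ := h1
  refine HasGoodNormalizer.of_conj (x := x⁻¹) ?_
  have hQR := conj_le hx
  have hQ1' : Q.map (MulAut.conj x⁻¹).toMonoidHom ≠ ⊥ := fun h =>
    hQ1 ((Subgroup.map_eq_bot_iff_of_injective _ (MulAut.conj x⁻¹).injective).1 h)
  generalize Q.map (MulAut.conj x⁻¹).toMonoidHom = Q at *
  by_cases h2 : ∃ x ∈ (ofH φ).range, ∀ q ∈ Q, x⁻¹ * q * x ∈ (Z k n).map (ofG φ)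
  · obtain ⟨y, -, hy⟩ := h2
    refine HasGoodNormalizer.of_conj (x := y⁻¹) ?_
    have hQZ := conj_le hy
    refine hG _ (hQZ.trans (Subgroup.map_mono (Z_le_R.trans (R_le_S hn hnp))))
      (normalizer_le_of_le_Z hn hnp hφ hQZ fun h => ?_)
    exact hQ1' ((Subgroup.map_eq_bot_iff_of_injective _ (MulAut.conj y⁻¹).injective).1 h)
  · push Not at h2
    have hRH : ∀ q ∈ Q, ∃ r : NR k n, (r : G k n) ∈ R k n ∧ ofH φ (toH φ r) = q := by
      intro q hq
      obtain ⟨r, hr, rfl⟩ := hQR hq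
      exact ⟨⟨r, mem_NR_of_mem_R hr⟩, hr, ofH_toH _⟩
    have hQ' : (Q.comap (ofH φ)).map (ofH φ) = Q :=
      Subgroup.map_comap_eq_self fun q hq => by
        obtain ⟨r, -, rfl⟩ := hRH q hq
        exact ⟨_, rfl⟩
    have hN := normalizer_le_of_le_R hn hnp hφ hQR h2
    rw [← hQ'] at hN ⊢
    refine hasGoodNormalizer_map (ofH_injective φ) (exists_conj_ofH_mem hn hnp φ)
      (hasCentricNormalSubgroup_H hn hnp hφ fun q hq => ?_) hN
    obtain ⟨r, hr, hrq⟩ := hRH _ hq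
    exact ⟨r, hr, ofH_injective φ hrq⟩

variable (p) in
/-- The subgroup of the amalgamated product generated by `O^{p'}(G)` and `O^{p'}(H_R)`. -/
noncomputable def residual (φ : NR k n ≃* Borel k) : Subgroup (Amalgam φ) :=
  (pPrimeResidual p (G k n)).map (ofG φ) ⊔ (pPrimeResidual p (H k)).map (ofH φ)

theorem closure_factors_le {W : Subgroup (Amalgam φ)} (hG : (ofG φ).range ≤ W)
    (hH : (ofH φ).range ≤ W) : W = ⊤ := by
  refine eq_top_iff.2 fun x _ => ?_
  induction x using Monoid.PushoutI.induction_on with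
  | of i g =>
    cases i with
    | false => exact hG ⟨g, rfl⟩
    | true => exact hH ⟨g, rfl⟩
  | base h => exact hG (Monoid.PushoutI.base_range_le false ⟨h, rfl⟩)
  | mul a b iha ihb => exact W.mul_mem (iha trivial) (ihb trivial)

theorem eq_top_of_residual_le [Finite k] (hn : 1 ≤ n) (hnp : n < p) {W : Subgroup (Amalgam φ)}
    (hL : residual p φ ≤ W) (hB : ∀ b : NR k n, ofG φ b ∈ W) : W = ⊤ := by
  refine closure_factors_le ?_ ?_
  · rw [MonoidHom.range_eq_map, ← pPrimeResidual_sup_NR hn hnp, Subgroup.map_sup]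
    refine sup_le (le_sup_left.trans hL) ?_
    rintro _ ⟨b, hb, rfl⟩
    exact hB ⟨b, hb⟩
  · rw [MonoidHom.range_eq_map, ← pPrimeResidual_sup_range_toH hn hnp φ, Subgroup.map_sup]
    refine sup_le (le_sup_right.trans hL) ?_
    rintro _ ⟨_, ⟨b, rfl⟩, rfl⟩
    rw [ofH_toH]
    exact hB b

theorem normal_residual [Finite k] (hn : 1 ≤ n) (hnp : n < p) : (residual p φ).Normal := by
  have hle : ∀ b : NR k n, residual p φ ≤
      (residual p φ).comap (MulAut.conj (ofG φ b)).toMonoidHom := by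
    intro b
    refine sup_le ?_ ?_
    · rintro _ ⟨g, hg, rfl⟩
      refine Subgroup.mem_sup_left
        ⟨b * g * (b : G k n)⁻¹, normal_pPrimeResidual.conj_mem g hg b, ?_⟩
      simp
    · rintro _ ⟨h, hh, rfl⟩
      refine Subgroup.mem_sup_right
        ⟨toH φ b * h * (toH φ b)⁻¹, normal_pPrimeResidual.conj_mem h hh _, ?_⟩
      rw [map_mul, map_mul, map_inv, ofH_toH]
      simp
  refine Subgroup.normalizer_eq_top_iff.1
    (eq_top_of_residual_le hn hnp Subgroup.le_normalizer fun b => ?_)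
  refine Subgroup.mem_normalizer_iff.2 fun x => ⟨fun hx => hle b hx, fun hx => ?_⟩
  have h := hle b⁻¹ hx
  simpa [mul_assoc] using h

theorem map_S_le_residual : (S k n).map (ofG φ) ≤ residual p φ := by
  refine le_trans (Subgroup.map_mono fun s hs => ?_) le_sup_left
  obtain ⟨j, hj⟩ := isPGroup_S (p := p) ⟨s, hs⟩
  exact mem_pPrimeResidual (j := j) (congrArg Subtype.val hj)

open scoped Pointwise in
/-- Since `N_G(R)` normalizes `S`, whatever is conjugate into `S` is so by an element of the normal
subgroup generated by `O^{p'}(G)` and `O^{p'}(H_R)`. -/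
theorem exists_residual_conj [Finite k] (hn : 1 ≤ n) (hnp : n < p) {T : Subgroup (Amalgam φ)}
    (hT : ∃ g, ∀ t ∈ T, g * t * g⁻¹ ∈ (S k n).map (ofG φ)) : T ≤ residual p φ ∧
      ∃ g ∈ residual p φ, ∀ t ∈ T, g * t * g⁻¹ ∈ (S k n).map (ofG φ) := by
  have hN := normal_residual (φ := φ) hn hnp
  obtain ⟨g, hg⟩ := hT
  refine ⟨fun t ht => ?_, ?_⟩
  · have h := hN.conj_mem _ (map_S_le_residual (hg t ht)) g⁻¹
    simpa [mul_assoc] using h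
  · have htop : baseRange φ ⊔ residual p φ = ⊤ := eq_top_of_residual_le hn hnp le_sup_right
      fun b => Subgroup.mem_sup_left (mem_baseRange_iff.2 ⟨b, rfl⟩)
    have hmem : g ∈ (baseRange φ : Set (Amalgam φ)) * (residual p φ : Set (Amalgam φ)) := by
      rw [← Subgroup.mul_normal, htop]
      trivial
    obtain ⟨b, hb, l, hl, rfl⟩ := hmem
    refine ⟨l, hl, fun t ht => ?_⟩
    obtain ⟨b, rfl⟩ := mem_baseRange_iff.1 hb
    obtain ⟨s, hs, hst⟩ := hg t ht
    refine ⟨(b⁻¹ : NR k n) * s * ((b⁻¹ : NR k n) : G k n)⁻¹,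
      conj_mem_S (lower_eq_zero_of_mem_NR hn hnp (b⁻¹ : NR k n).2) hs, ?_⟩
    rw [map_mul, map_mul, hst]
    simp only [Subgroup.coe_inv, map_inv]
    group

end Amalgam

theorem isOfCharacteristicPType_fusionSystem {k : Type u} [Field k] [Finite k] {n p : ℕ}
    [Fact p.Prime] [CharP k p] (hn : 1 ≤ n) (hnp : n < p) {φ : NR k n ≃* Borel k}
    (hφ : CarriesR φ) {M : Subgroup (Amalgam φ)} (hM : residual p φ ≤ M) :
    (fusionSystem φ M).IsOfCharacteristicPType p := by
  have hfin : Finite (G k n) := finite_G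
  have hSM : (S k n).map (ofG φ) ≤ M := map_S_le_residual.trans hM
  let P : Subgroup M := ((S k n).map (ofG φ)).subgroupOf M
  let ι : P →* Amalgam φ := M.subtype.comp P.subtype
  have hι : Function.Injective ι :=
    (Subgroup.subtype_injective M).comp (Subgroup.subtype_injective P)
  have hrange : ι.range = (S k n).map (ofG φ) := by
    rw [MonoidHom.range_comp, Subgroup.range_subtype]
    exact Subgroup.map_subgroupOf_eq_of_le hSM
  have hPp : IsPGroup p P := ((isPGroup_S (p := p)).map (ofG φ)).comap_subtype
  have hPfin : Finite P := by
    have h1 : Finite ι.range := by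
      rw [hrange]
      exact Finite.of_surjective _ ((ofG φ).subgroupMap_surjective (S k n))
    exact Finite.of_injective _ (MonoidHom.rangeRestrict_injective_iff.2 hι)
  have hF : (fusionSystem φ M).IsRealizedBy ι M := by
    refine ⟨hι, fun s => (s : M).2, fun {V W} f => ⟨?_, ?_⟩⟩
    · rintro ⟨g, hg⟩
      exact ⟨g, g.2, fun x => congrArg Subtype.val (hg x)⟩
    · rintro ⟨g, hgM, hg⟩
      exact ⟨⟨g, hgM⟩, fun x => Subtype.ext (hg x)⟩
  have key : ∀ Q : Subgroup P, Q ≠ ⊥ →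
      HasGoodNormalizer p ((S k n).map (ofG φ)) (Q.map ι) := fun Q hQ =>
    hasGoodNormalizer hn hnp hφ ((Subgroup.map_le_range _ _).trans hrange.le) fun h =>
      hQ ((Subgroup.map_eq_bot_iff_of_injective _ hι).1 h)
  refine hF.isOfCharacteristicPType hPp (fun Q hQ => ?_) (fun Q hQ T hT hTp => ?_) fun Q hQ => ?_
  · have := (key Q hQ).finite
    exact Finite.of_injective _ (Subgroup.inclusion_injective inf_le_right)
  · obtain ⟨-, g, hg, h⟩ :=
      exists_residual_conj hn hnp ((key Q hQ).conj T (hT.trans inf_le_right) hTp)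
    refine ⟨g, hM hg, ?_⟩
    rwa [hrange]
  · obtain ⟨X, hXN, hXp, hNX, hXc⟩ := (key Q hQ).centric
    refine ⟨X, le_inf ?_ hXN, hXp, inf_le_right.trans hNX, fun y hy => hXc y hy.2⟩
    exact (exists_residual_conj hn hnp ((key Q hQ).conj X hXN hXp)).1.trans hM

end ClellandParker

theorem proposition5p12 {k : Type u} [Field k] [Finite k] (p : ℕ) [Fact p.Prime] (hp : p ≠ 2)
    [CharP k p] (n r : ℕ) (hn : 1 ≤ n) (hnp : n ≤ p - 1)
    (hr : r ∣ Nat.gcd (n + 2) (Nat.card k - 1))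
    (φ : ClellandParker.NR k n ≃* ClellandParker.Borel k)
    (hφ : ∀ x : ClellandParker.NR k n,
      (x : ClellandParker.G k n) ∈ ClellandParker.R k n ↔
        (φ x : GL (Fin 3) k) ∈ ClellandParker.unipotentRadical k)
    (M : Subgroup (ClellandParker.Amalgam φ)) (hM : M.index = r)
    (hG : (pPrimeResidual p (ClellandParker.G k n)).map (ClellandParker.ofG φ) ≤ M)
    (hH : (pPrimeResidual p (ClellandParker.H k)).map (ClellandParker.ofH φ) ≤ M) :
    (ClellandParker.fusionSystem φ M).IsOfCharacteristicPType p :=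
  ClellandParker.isOfCharacteristicPType_fusionSystem hn
    (Nat.lt_of_le_pred (Fact.out : p.Prime).pos hnp) hφ (sup_le hG hH)
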